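/- For every integer $n \ge 0$ there is a circuit $C_n$, made of Toffoli, $\mathsf{CNOT}$ and $\mathsf{X}$ gates only, that acts on exactly the $2n+1$ qubits of two $n$-qubit registers and one further qubit (so there are no ancilla qubits) and implements the in-place addition of $n$-bit integers: for all $a, b \in \{0, \ldots, 2^n-1\}$ and $z \in \{0,1\}$, \[ |a\rangle\,|b\rangle\,|z\rangle \;\mapsto\; |a\rangle\,|a+b \bmod 2^n\rangle\,|z \oplus (a+b)_n\rangle , \] where an $n$-bit integer is stored in binary in its register, and $(a+b)_n$ is the bit of $a+b$ of weight $2^n$ (the carry out). As $n \to \infty$, $C_n$ has depth $O(\log^2 n)$ and $O(n \log n)$ gates. Here the depth of a circuit is the length of a longest subsequence of its gates in which any two consecutive gates have a qubit in common (equivalently, the least number of layers of gates on pairwise disjoint sets of qubits into which the circuit can be arranged without changing the order of gates that share a qubit). -/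

import Mathlib

namespace QuantumAdder

/-- The gates of the gate set {Toffoli, CNOT, X}, placed on a set `Q` of qubits. The qubits on
which a gate acts are pairwise distinct; the last qubit listed is the target. -/
inductive Gate (Q : Type) : Type where
  | X (t : Q) : Gate Q
  | CNOT (c t : Q) (h : c ≠ t) : Gate Q
  | Toffoli (c₁ c₂ t : Q) (h : c₁ ≠ c₂) (h₁ : c₁ ≠ t) (h₂ : c₂ ≠ t) : Gate Q

section Semantics

variable {Q : Type} [DecidableEq Q]

/-- The set of qubits on which a gate acts. -/
def Gate.support : Gate Q → Finset Q
  | .X t => {t}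
  | .CNOT c t _ => {c, t}
  | .Toffoli c₁ c₂ t _ _ _ => {c₁, c₂, t}

/-- The action of a gate on the labels `x : Q → Bool` of the computational basis: the target is
XORed with the product of the controls (with `1` for the gate `X`). -/
def Gate.action : Gate Q → (Q → Bool) → (Q → Bool)
  | .X t, x => Function.update x t (x t ^^ true)
  | .CNOT c t _, x => Function.update x t (x t ^^ x c)
  | .Toffoli c₁ c₂ t _ _ _, x => Function.update x t (x t ^^ (x c₁ && x c₂))

/-- The computational basis state `|x⟩`, as a vector of the state space `ℂ ^ (Q → Bool)` of the
qubits in `Q`. -/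
def ket (x : Q → Bool) [Fintype Q] : (Q → Bool) → ℂ := Pi.single x 1

/-- The operator of a gate, i.e. the linear operator with `|x⟩ ↦ |action x⟩`, as a matrix in the
computational basis. -/
def Gate.operator [Fintype Q] (g : Gate Q) : Matrix (Q → Bool) (Q → Bool) ℂ :=
  Matrix.of fun y x => if y = g.action x then 1 else 0

/-- A circuit on the qubits `Q`: a finite sequence of gates, the head being applied first. The
qubits of `Q` are the only ones there are, so any ancilla has to be an element of `Q`. -/
abbrev Circuit (Q : Type) : Type := List (Gate Q)

/-- The operator of a circuit, the composition of the operators of its gates. -/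
def Circuit.operator [Fintype Q] : Circuit Q → Matrix (Q → Bool) (Q → Bool) ℂ
  | [] => 1
  | g :: C => Circuit.operator C * g.operator

/-- The gate count of a circuit. -/
def Circuit.gateCount (C : Circuit Q) : ℕ := C.length

/-- Two gates have a qubit in common, so that they cannot be carried out at the same time. -/
def Gate.Overlap (g h : Gate Q) : Prop := ¬ Disjoint g.support h.support

instance : DecidableRel (Gate.Overlap (Q := Q)) :=
  fun g h => inferInstanceAs (Decidable (¬ Disjoint g.support h.support))

/-- The depth of a circuit: the length of a longest path in its dependency graph, i.e. of a
longest subsequence of its gates in which any two consecutive ones have a qubit in common.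
It is the least number of layers of gates on disjoint sets of qubits into which the
circuit can be arranged without changing the order of gates that share a qubit. -/
def Circuit.depth (C : Circuit Q) : ℕ :=
  ((C.sublists.filter fun l => l.IsChain Gate.Overlap).map List.length).foldr max 0

end Semantics

/-- The `2 * n + 1` qubits `A 0, …, A (n-1)`, `B 0, …, B (n-1)`, `Z` of an adder without ancilla
qubits. -/
abbrev AdderQubit (n : ℕ) : Type := Fin n ⊕ Fin n ⊕ Unit

/-- The label of the basis state `|a⟩|b⟩|z⟩`: qubit `i` of the first register holds bit `i` of `a`
(bit `0` is the least significant), likewise for `b`, and the last qubit holds `z`. -/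
def adderLabel (n a b : ℕ) (z : Bool) : AdderQubit n → Bool
  | .inl i => a.testBit i
  | .inr (.inl i) => b.testBit i
  | .inr (.inr _) => z

/-- The circuit `C` implements the in-place addition of `n`-bit integers. -/
def ImplementsAddition (n : ℕ) (C : Circuit (AdderQubit n)) : Prop :=
  ∀ a b : ℕ, a < 2 ^ n → b < 2 ^ n → ∀ z : Bool,
    (Circuit.operator C).mulVec (ket (adderLabel n a b z)) =
      ket (adderLabel n a ((a + b) % 2 ^ n) (z ^^ (a + b).testBit n))

end QuantumAdder

/-!
Let `c i` be the carry into place `i` and `p i = a i ⊕ b i`. Then `y i = a i ⊕ c i` satisfies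
`y (i + 1) = (a (i + 1) ⊕ a i) ⊕ p i * y i`. Hence, once `p` has been stored in the second register,
an inverse ladder of `CNOT` gates on the first register followed by a ladder of Toffoli gates turns
`a` into `y`, the carry out being added to the last qubit. Adding `y` to the second register
yields `b i ⊕ c i`, and `p i * y i = ¬(b i ⊕ c i) * y i`, so that the Toffoli ladder can be undone
with the negated second register as controls; undoing the `CNOT` ladder too and adding `a` to the
second register, one arrives at the sum (`run_adder`).

A ladder has logarithmically many levels (`ladder`). At level `l`, the recurrence above has been
restricted to the multiples of `2 ^ l`, the coefficients being products of `2 ^ l` consecutive ones;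
combining pairs of adjacent blocks leads to the next level. Each level consists of two parallel
layers of gates with `2 ^ l + 1` controls, one layer before and one after the higher levels
(`IsBlockFamily.run_ladder`).

What remains is to carry out such a multiply controlled gate with `O(2 ^ l)` gates in depth `O(l)`,
using no other qubits than those of its block, of which those that are neither controls nor
target have unknown contents. For a wire `q` that holds `1`, the step `q ← ¬q ⊕ ab` stores the product
`ab` in `q`, and if this product is `1`, then so are `a` and `b`, which may serve as clean wires from
then on (`Step.controls_of_act`). Starting with three controls assumed to be `1`, the other
controls are processed in stages of doubling size (`stageSteps`): a stage multiplies its controls in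
a binary tree, whose inner nodes are stored in controls processed earlier. The final result is `1` precisely when
all controls are `1`, provided that the first three are (`stageSteps_infer`,
`clean_and_prodSteps`). The successive trees overlap in time, a stage starting one time unit after
the preceding one, so that the depth is linear in the number of stages (`depthLE_stageSteps`).
The assumption on the first three controls is enforced by XORing their product onto a wire of unknown
content and adding the result, multiplied with this wire, to the target once with this product
and once without it (`largeMCX`).

The circuits are built on wires numbered by natural numbers, the bits of the two registers being
interleaved, so that blocks of bits are intervals of wires; at the end the wires are renamed.
-/

namespace QuantumAdder

/-! ### The action of a circuit on basis states -/

/-- The action of a circuit on the labels of the basis states: the composition of the actions of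
its gates, the head being applied first. -/
def run {Q : Type} [DecidableEq Q] : Circuit Q → (Q → Bool) → Q → Bool
  | [], x => x
  | g :: C, x => run C (g.action x)

section General

variable {Q : Type} [DecidableEq Q]

@[simp] theorem run_nil (x : Q → Bool) : run [] x = x := rfl

@[simp] theorem run_cons (g : Gate Q) (C : Circuit Q) (x : Q → Bool) :
    run (g :: C) x = run C (g.action x) := rfl

@[simp] theorem run_append (C D : Circuit Q) (x : Q → Bool) :
    run (C ++ D) x = run D (run C x) := by
  induction C generalizing x with
  | nil => rfl
  | cons g C ih => simp [ih]

theorem Circuit.operator_mulVec_ket [Fintype Q] (C : Circuit Q) (x : Q → Bool) :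
    (Circuit.operator C).mulVec (ket x) = ket (run C x) := by
  induction C generalizing x with
  | nil => simp [Circuit.operator]
  | cons g C ih =>
    have hg : (Gate.operator g).mulVec (ket x) = ket (g.action x) := by
      ext y
      simp [ket, Gate.operator, Pi.single_apply]
    rw [Circuit.operator, ← Matrix.mulVec_mulVec, hg, ih, run_cons]

theorem Gate.action_action (g : Gate Q) (x : Q → Bool) : g.action (g.action x) = x := by
  cases g with
  | X t => simp [Gate.action]
  | CNOT c t h => simp [Gate.action, Function.update_of_ne h]
  | Toffoli c₁ c₂ t h h₁ h₂ =>
    simp [Gate.action, Function.update_of_ne h₁, Function.update_of_ne h₂]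

theorem run_reverse_run (C : Circuit Q) (x : Q → Bool) : run C.reverse (run C x) = x := by
  induction C generalizing x with
  | nil => rfl
  | cons g C ih => simp [ih, Gate.action_action]

theorem run_reverse_of_run_eq {C : Circuit Q} {x y : Q → Bool} (h : run C x = y) :
    run C.reverse y = x := by
  rw [← h, run_reverse_run]

theorem Gate.action_update (g : Gate Q) {w : Q} (hw : w ∉ g.support) (x : Q → Bool) (v : Bool) :
    g.action (Function.update x w v) = Function.update (g.action x) w v := by
  cases g with
  | X t =>
    simp only [Gate.support, Finset.mem_singleton] at hw
    simp [Gate.action, Function.update_of_ne (Ne.symm hw), Function.update_comm hw]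
  | CNOT c t h =>
    simp only [Gate.support, Finset.mem_insert, Finset.mem_singleton, not_or] at hw
    simp [Gate.action, Function.update_of_ne (Ne.symm hw.1), Function.update_of_ne (Ne.symm hw.2),
      Function.update_comm hw.2]
  | Toffoli c₁ c₂ t h h₁ h₂ =>
    simp only [Gate.support, Finset.mem_insert, Finset.mem_singleton, not_or] at hw
    simp [Gate.action, Function.update_of_ne (Ne.symm hw.1), Function.update_of_ne (Ne.symm hw.2.1),
      Function.update_of_ne (Ne.symm hw.2.2), Function.update_comm hw.2.2]

/-- A circuit commutes with any change of a qubit that it does not touch. -/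
theorem run_update {C : Circuit Q} {w : Q} (hw : ∀ g ∈ C, w ∉ g.support) (x : Q → Bool) (v : Bool) :
    run C (Function.update x w v) = Function.update (run C x) w v := by
  induction C generalizing x with
  | nil => rfl
  | cons g C ih =>
    rw [List.forall_mem_cons] at hw
    rw [run_cons, run_cons, g.action_update hw.1, ih hw.2]

theorem run_apply_of_notMem {C : Circuit Q} {w : Q} (hw : ∀ g ∈ C, w ∉ g.support) (x : Q → Bool) :
    run C x w = x w := by
  have h := run_update hw x (x w)
  rw [Function.update_eq_self] at h
  rw [h, Function.update_self]

/-! ### Depth -/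

/-- `DepthLE C d` says that the depth of `C` is at most `d`, in terms of the paths in the
dependency graph of `C`. -/
def DepthLE (C : Circuit Q) (d : ℕ) : Prop :=
  ∀ l : List (Gate Q), l.Sublist C → l.IsChain Gate.Overlap → l.length ≤ d

theorem DepthLE.depth_le {C : Circuit Q} {d : ℕ} (h : DepthLE C d) : Circuit.depth C ≤ d := by
  unfold Circuit.depth
  have key : ∀ l : List ℕ, (∀ k ∈ l, k ≤ d) → l.foldr max 0 ≤ d := by
    intro l
    induction l with
    | nil => simp
    | cons k l ih =>
      intro hl
      rw [List.forall_mem_cons] at hl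
      exact max_le hl.1 (ih hl.2)
  refine key _ fun k hk => ?_
  simp only [List.mem_map, List.mem_filter, List.mem_sublists, decide_eq_true_eq] at hk
  obtain ⟨l, ⟨hl, hc⟩, rfl⟩ := hk
  exact h l hl hc

theorem DepthLE.mono {C : Circuit Q} {d e : ℕ} (h : DepthLE C d) (hde : d ≤ e) : DepthLE C e :=
  fun l hl hc => (h l hl hc).trans hde

theorem depthLE_length (C : Circuit Q) : DepthLE C C.length := fun _ hl _ => hl.length_le

theorem DepthLE.append {C D : Circuit Q} {d e : ℕ} (hC : DepthLE C d) (hD : DepthLE D e) :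
    DepthLE (C ++ D) (d + e) := by
  intro l hl hc
  obtain ⟨l₁, l₂, rfl, h₁, h₂⟩ := List.sublist_append_iff.1 hl
  rw [List.length_append]
  exact add_le_add (hC l₁ h₁ hc.left_of_append) (hD l₂ h₂ hc.right_of_append)

theorem Gate.Overlap.symm {g h : Gate Q} (H : Gate.Overlap g h) : Gate.Overlap h g :=
  fun hd => H hd.symm

theorem DepthLE.reverse {C : Circuit Q} {d : ℕ} (h : DepthLE C d) : DepthLE C.reverse d := by
  intro l hl hc
  rw [← List.length_reverse]
  refine h l.reverse (by simpa using hl.reverse) ?_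
  rw [List.isChain_reverse]
  exact hc.imp fun _ _ => Gate.Overlap.symm

/-- Circuits on disjoint sets of qubits can be carried out in parallel. -/
theorem DepthLE.append_of_disjoint {C D : Circuit Q} {d : ℕ} (hC : DepthLE C d) (hD : DepthLE D d)
    (h : ∀ g ∈ C, ∀ g' ∈ D, Disjoint g.support g'.support) : DepthLE (C ++ D) d := by
  intro l hl hc
  obtain ⟨l₁, l₂, rfl, h₁, h₂⟩ := List.sublist_append_iff.1 hl
  rcases l₂ with _ | ⟨g', l₂⟩
  · simpa using hC l₁ h₁ hc.left_of_append
  rcases List.eq_nil_or_concat l₁ with rfl | ⟨l₁, g, rfl⟩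
  · simpa using hD _ h₂ (by simpa using hc)
  · have h3 := (List.isChain_append.1 hc).2.2 g (by simp) g' (by simp)
    exact absurd (h g (h₁.subset (by simp)) g' (h₂.subset (by simp))) h3

theorem depthLE_flatMap {ι : Type*} {f : ι → Circuit Q} {d : ℕ} {l : List ι}
    (hd : ∀ i ∈ l, DepthLE (f i) d)
    (h : l.Pairwise fun i j => ∀ g ∈ f i, ∀ g' ∈ f j, Disjoint g.support g'.support) :
    DepthLE (l.flatMap f) d := by
  induction l with
  | nil =>
    intro m hm _
    simp only [List.flatMap_nil, List.sublist_nil] at hm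
    simp [hm]
  | cons i l ih =>
    rw [List.forall_mem_cons] at hd
    rw [List.pairwise_cons] at h
    rw [List.flatMap_cons]
    refine hd.1.append_of_disjoint (ih hd.2 h.2) fun g hg g' hg' => ?_
    obtain ⟨j, hj, hg'⟩ := List.mem_flatMap.1 hg'
    exact h.1 j hj g hg g' hg'

/-- If the gates can be given times below `T` in such a way that of two gates with a common qubit
the one listed first has the smaller time, then the depth is at most `T`. -/
theorem depthLE_of_times {l : List (ℕ × Gate Q)} {T : ℕ} (hT : ∀ p ∈ l, p.1 < T)
    (h : l.Pairwise fun p q => Gate.Overlap p.2 q.2 → p.1 < q.1) :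
    DepthLE (l.map Prod.snd) T := by
  intro m hm hc
  obtain ⟨l', hl', rfl⟩ := List.sublist_map_iff.1 hm
  rw [List.isChain_map] at hc
  have hp : l'.Pairwise fun p q => Gate.Overlap p.2 q.2 → p.1 < q.1 := h.sublist hl'
  have hc' : (l'.map Prod.fst).IsChain (· < ·) := by
    rw [List.isChain_map]
    rw [List.isChain_iff_getElem] at hc ⊢
    intro i hi
    exact List.pairwise_iff_getElem.1 hp i (i + 1) _ hi (Nat.lt_succ_self i) (hc i hi)
  have hnd : (l'.map Prod.fst).Nodup := (List.isChain_iff_pairwise.1 hc').imp fun H => H.ne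
  have hsub : (l'.map Prod.fst) ⊆ List.range T := by
    intro t ht
    obtain ⟨p, hp, rfl⟩ := List.mem_map.1 ht
    exact List.mem_range.2 (hT p (hl'.subset hp))
  simpa using (hnd.subperm hsub).length_le

end General

/-! ### Circuits on wires numbered by natural numbers -/

/-- The `CNOT` gate as a circuit; the empty circuit if the two wires coincide. -/
def cnot (c t : ℕ) : Circuit ℕ := if h : c ≠ t then [.CNOT c t h] else []

/-- The Toffoli gate as a circuit; the empty circuit if the three wires are not distinct. -/
def tof (c₁ c₂ t : ℕ) : Circuit ℕ :=
  if h : c₁ ≠ c₂ ∧ c₁ ≠ t ∧ c₂ ≠ t then [.Toffoli c₁ c₂ t h.1 h.2.1 h.2.2] else []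

/-- Every gate of `C` acts on wires satisfying `p` only. -/
def ActsOn (C : Circuit ℕ) (p : ℕ → Prop) : Prop := ∀ g ∈ C, ∀ w ∈ g.support, p w

theorem run_cnot {c t : ℕ} (h : c ≠ t) (x : ℕ → Bool) :
    run (cnot c t) x = Function.update x t (x t ^^ x c) := by
  simp [cnot, h, Gate.action]

theorem run_tof {c₁ c₂ t : ℕ} (h : c₁ ≠ c₂) (h₁ : c₁ ≠ t) (h₂ : c₂ ≠ t) (x : ℕ → Bool) :
    run (tof c₁ c₂ t) x = Function.update x t (x t ^^ (x c₁ && x c₂)) := by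
  simp [tof, h, h₁, h₂, Gate.action]

theorem length_cnot_le (c t : ℕ) : (cnot c t).length ≤ 1 := by
  unfold cnot; split <;> simp

theorem length_tof_le (c₁ c₂ t : ℕ) : (tof c₁ c₂ t).length ≤ 1 := by
  unfold tof; split <;> simp

theorem actsOn_nil (p : ℕ → Prop) : ActsOn [] p := by simp [ActsOn]

theorem actsOn_X {p : ℕ → Prop} {t : ℕ} (ht : p t) : ActsOn [.X t] p := by
  simpa [ActsOn, Gate.support] using ht

theorem actsOn_cnot {p : ℕ → Prop} {c t : ℕ} (hc : p c) (ht : p t) : ActsOn (cnot c t) p := by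
  unfold cnot
  split
  · simp [ActsOn, Gate.support, hc, ht]
  · exact actsOn_nil p

theorem actsOn_tof {p : ℕ → Prop} {c₁ c₂ t : ℕ} (h₁ : p c₁) (h₂ : p c₂) (ht : p t) :
    ActsOn (tof c₁ c₂ t) p := by
  unfold tof
  split
  · simp [ActsOn, Gate.support, h₁, h₂, ht]
  · exact actsOn_nil p

theorem ActsOn.append {C D : Circuit ℕ} {p : ℕ → Prop} (hC : ActsOn C p) (hD : ActsOn D p) :
    ActsOn (C ++ D) p := by
  intro g hg
  rcases List.mem_append.1 hg with h | h
  exacts [hC g h, hD g h]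

theorem ActsOn.reverse {C : Circuit ℕ} {p : ℕ → Prop} (hC : ActsOn C p) : ActsOn C.reverse p :=
  fun g hg => hC g (List.mem_reverse.1 hg)

theorem ActsOn.mono {C : Circuit ℕ} {p q : ℕ → Prop} (hC : ActsOn C p) (h : ∀ w, p w → q w) :
    ActsOn C q := fun g hg w hw => h w (hC g hg w hw)

theorem actsOn_flatMap {ι : Type*} {l : List ι} {f : ι → Circuit ℕ} {p : ℕ → Prop}
    (h : ∀ i ∈ l, ActsOn (f i) p) : ActsOn (l.flatMap f) p := by
  intro g hg
  obtain ⟨i, hi, hg⟩ := List.mem_flatMap.1 hg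
  exact h i hi g hg

theorem ActsOn.notMem {C : Circuit ℕ} {p : ℕ → Prop} (h : ActsOn C p) {w : ℕ} (hw : ¬ p w) :
    ∀ g ∈ C, w ∉ g.support := fun g hg hmem => hw (h g hg w hmem)

theorem ActsOn.run_apply {C : Circuit ℕ} {p : ℕ → Prop} (h : ActsOn C p) {w : ℕ} (hw : ¬ p w)
    (x : ℕ → Bool) : run C x w = x w := run_apply_of_notMem (h.notMem hw) x

/-! ### Multiply controlled gates of bounded size -/

/-- The gate that XORs the product of the wires `cs` onto `t`, built from Toffoli gates by means of
the wires `ds`, whose contents are arbitrary and are restored. The number of gates is exponential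
in the number of controls. -/
def smallMCX : List ℕ → List ℕ → ℕ → Circuit ℕ
  | [], _, t => [.X t]
  | [c], _, t => cnot c t
  | [c₁, c₂], _, t => tof c₁ c₂ t
  | c :: c' :: c'' :: cs, d :: ds, t =>
    tof c d t ++ smallMCX (c' :: c'' :: cs) ds d ++ tof c d t ++ smallMCX (c' :: c'' :: cs) ds d
  | _ :: _ :: _ :: _, [], _ => []

theorem run_smallMCX (cs ds : List ℕ) (t : ℕ) (hlen : cs.length ≤ ds.length + 2)
    (hnd : (t :: (cs ++ ds)).Nodup) (x : ℕ → Bool) :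
    run (smallMCX cs ds t) x = Function.update x t (x t ^^ cs.all x) := by
  induction cs, ds, t using smallMCX.induct generalizing x with
  | case1 ds t => simp [smallMCX, Gate.action]
  | case2 c ds t =>
    have h : c ≠ t := by
      simp only [List.cons_append, List.nodup_cons, List.mem_cons, not_or] at hnd
      exact Ne.symm hnd.1.1
    simp [smallMCX, run_cnot h]
  | case3 c₁ c₂ ds t =>
    simp only [List.cons_append, List.nodup_cons, List.mem_cons, not_or] at hnd
    simp [smallMCX, run_tof hnd.2.1.1 (Ne.symm hnd.1.1) (Ne.symm hnd.1.2.1)]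
  | case4 c c' c'' cs d ds t ih =>
    have hstep : smallMCX (c :: c' :: c'' :: cs) (d :: ds) t =
        tof c d t ++ smallMCX (c' :: c'' :: cs) ds d ++ tof c d t ++
          smallMCX (c' :: c'' :: cs) ds d := by simp only [smallMCX]
    rw [hstep]
    clear hstep
    generalize c' :: c'' :: cs = l at *
    have h1 : (d :: (l ++ ds)).Nodup := by
      have : (d :: (l ++ ds)).Perm (l ++ d :: ds) := List.perm_middle.symm
      rw [this.nodup_iff]
      exact (List.nodup_cons.1 (List.nodup_cons.1 hnd).2).2
    simp only [List.cons_append, List.nodup_cons, List.mem_cons, List.mem_append, not_or] at hnd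
    have h2 : c ≠ d ∧ c ∉ l := ⟨hnd.2.1.2.1, hnd.2.1.1⟩
    have h3 : t ≠ c ∧ t ∉ l ∧ t ≠ d := ⟨hnd.1.1, hnd.1.2.1, hnd.1.2.2.1⟩
    have h4 : d ∉ l := fun h => (List.nodup_cons.1 h1).1 (List.mem_append_left _ h)
    have hall : ∀ (y : ℕ → Bool) (w : ℕ) (v : Bool), w ∉ l →
        l.all (Function.update y w v) = l.all y := by
      intro y w v hw
      rw [Bool.eq_iff_iff, List.all_eq_true, List.all_eq_true]
      refine forall₂_congr fun u hu => ?_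
      rw [Function.update_of_ne (by rintro rfl; exact hw hu)]
    have ih' := ih (by simp only [List.length_cons] at hlen; omega) h1
    simp only [run_append, ih', run_tof h2.1 (Ne.symm h3.1) (Ne.symm h3.2.2),
      hall _ _ _ h3.2.1, hall _ _ _ h4, Function.update_self, List.all_cons,
      Function.update_of_ne h3.2.2, Function.update_of_ne (Ne.symm h3.2.2),
      Function.update_of_ne h2.1, Function.update_of_ne (Ne.symm h3.1)]
    ext w
    by_cases hwd : w = d
    · subst hwd
      simp [Function.update_of_ne (Ne.symm h3.2.2)]
    · by_cases hwt : w = t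
      · subst hwt
        simp only [Function.update_of_ne hwd, Function.update_self]
        cases x w <;> cases x c <;> cases x d <;> cases l.all x <;> rfl
      · simp [Function.update_of_ne hwd, Function.update_of_ne hwt]
  | case5 c c' c'' cs t => simp at hlen

theorem actsOn_smallMCX {p : ℕ → Prop} (cs ds : List ℕ) (t : ℕ) (hc : ∀ c ∈ cs, p c)
    (hd : ∀ d ∈ ds, p d) (ht : p t) : ActsOn (smallMCX cs ds t) p := by
  induction cs, ds, t using smallMCX.induct with
  | case1 ds t => exact actsOn_X ht
  | case2 c ds t => exact actsOn_cnot (hc c (by simp)) ht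
  | case3 c₁ c₂ ds t => exact actsOn_tof (hc _ (by simp)) (hc _ (by simp)) ht
  | case4 c c' c'' cs d ds t ih =>
    rw [List.forall_mem_cons] at hc hd
    have h1 := ih hc.2 hd.2 hd.1
    have h2 : ActsOn (tof c d t) p := actsOn_tof hc.1 hd.1 ht
    exact ((h2.append h1).append h2).append h1
  | case5 c c' c'' cs t => exact actsOn_nil p

theorem length_smallMCX_le (cs ds : List ℕ) (t : ℕ) :
    (smallMCX cs ds t).length + 2 ≤ 4 * 2 ^ cs.length := by
  induction cs, ds, t using smallMCX.induct with
  | case1 ds t => simp [smallMCX]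
  | case2 c ds t => have := length_cnot_le c t; simp only [smallMCX, List.length_singleton]; omega
  | case3 c₁ c₂ ds t => have := length_tof_le c₁ c₂ t; simp [smallMCX]; omega
  | case4 c c' c'' cs d ds t ih =>
    have := length_tof_le c d t
    simp only [smallMCX, List.length_append, List.length_cons, pow_succ] at ih ⊢
    omega
  | case5 c c' c'' cs t =>
    have : 0 < 2 ^ cs.length := by positivity
    simp only [smallMCX, List.length_cons, List.length_nil, pow_succ]; omega

/-! ### Sequences of clean-wire steps -/

/-- A step `q ← ¬q ⊕ ab` on the wires `a`, `b`, `q`, carried out by the gate `X` and a Toffoli gate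
at time `time`. If `q` holds `1`, then it becomes the product of `a` and `b`. -/
structure Step where
  /-- the time at which the step is carried out -/
  time : ℕ
  /-- the first control -/
  a : ℕ
  /-- the second control -/
  b : ℕ
  /-- the target -/
  q : ℕ

/-- The three wires of a step are distinct. -/
def Step.Distinct (s : Step) : Prop := s.a ≠ s.b ∧ s.a ≠ s.q ∧ s.b ≠ s.q

/-- The wire `v` is one of the three wires of the step. -/
def Step.Uses (s : Step) (v : ℕ) : Prop := v = s.a ∨ v = s.b ∨ v = s.q

/-- The gates of a step. -/
def Step.circuit (s : Step) : Circuit ℕ := .X s.q :: tof s.a s.b s.q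

/-- The action of a step on the labels of the basis states. -/
def Step.act (s : Step) (x : ℕ → Bool) : ℕ → Bool :=
  Function.update x s.q (!x s.q ^^ (x s.a && x s.b))

/-- The action of a sequence of steps. -/
def stepsRun : List Step → (ℕ → Bool) → ℕ → Bool
  | [], x => x
  | s :: S, x => stepsRun S (s.act x)

/-- The circuit of a sequence of steps. -/
def stepsCircuit (S : List Step) : Circuit ℕ := S.flatMap Step.circuit

theorem stepsRun_append (S T : List Step) (x : ℕ → Bool) :
    stepsRun (S ++ T) x = stepsRun T (stepsRun S x) := by
  induction S generalizing x with
  | nil => rfl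
  | cons s S ih => exact ih _

theorem run_stepsCircuit {S : List Step} (hS : ∀ s ∈ S, s.Distinct) (x : ℕ → Bool) :
    run (stepsCircuit S) x = stepsRun S x := by
  induction S generalizing x with
  | nil => rfl
  | cons s S ih =>
    rw [List.forall_mem_cons] at hS
    obtain ⟨h, h₁, h₂⟩ := hS.1
    rw [stepsCircuit, List.flatMap_cons, run_append, ← stepsCircuit, ih hS.2, stepsRun]
    congr 1
    simp [Step.circuit, run_tof h h₁ h₂, Gate.action, Step.act, Function.update_of_ne h₁,
      Function.update_of_ne h₂]

theorem stepsRun_apply_of_ne {S : List Step} {w : ℕ} (hw : ∀ s ∈ S, s.q ≠ w) (x : ℕ → Bool) :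
    stepsRun S x w = x w := by
  induction S generalizing x with
  | nil => rfl
  | cons s S ih =>
    rw [List.forall_mem_cons] at hw
    rw [stepsRun, ih hw.2, Step.act, Function.update_of_ne hw.1.symm]

/-- A state in which all wires of the steps hold `1` is a fixed point of the steps. -/
theorem stepsRun_eq_self {S : List Step} {x : ℕ → Bool}
    (h : ∀ s ∈ S, x s.a = true ∧ x s.b = true ∧ x s.q = true) : stepsRun S x = x := by
  induction S with
  | nil => rfl
  | cons s S ih =>
    rw [List.forall_mem_cons] at h
    have : s.act x = x := by
      rw [Step.act, h.1.1, h.1.2.1, h.1.2.2]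
      simp [← h.1.2.2]
    rw [stepsRun, this, ih h.2]

/-- If the target of a step holds `1` before and after the step, then so do the controls. -/
theorem Step.controls_of_act {s : Step} {x : ℕ → Bool} (h : x s.q = true)
    (h' : s.act x s.q = true) : x s.a = true ∧ x s.b = true := by
  simpa [Step.act, h] using h'

theorem actsOn_stepsCircuit {p : ℕ → Prop} {S : List Step}
    (h : ∀ s ∈ S, ∀ v, s.Uses v → p v) : ActsOn (stepsCircuit S) p := by
  refine actsOn_flatMap fun s hs => ?_
  have hq : p s.q := h s hs _ (Or.inr (Or.inr rfl))
  have := (actsOn_X hq).append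
    (actsOn_tof (h s hs _ (Or.inl rfl)) (h s hs _ (Or.inr (Or.inl rfl))) hq)
  exact this

theorem length_stepsCircuit_le (S : List Step) : (stepsCircuit S).length ≤ 2 * S.length := by
  induction S with
  | nil => simp [stepsCircuit]
  | cons s S ih =>
    have := length_tof_le s.a s.b s.q
    simp only [stepsCircuit, List.flatMap_cons, List.length_append, Step.circuit,
      List.length_cons] at ih ⊢
    omega

/-- Steps whose times are consistent with their order can be carried out within these times, each
time unit being used for an `X` and a Toffoli gate. -/
theorem depthLE_stepsCircuit {S : List Step} {T : ℕ} (hT : ∀ s ∈ S, s.time < T)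
    (h : S.Pairwise fun s s' => ∀ v, s.Uses v → s'.Uses v → s.time < s'.time) :
    DepthLE (stepsCircuit S) (2 * T) := by
  let f : Step → List (ℕ × Gate ℕ) := fun s =>
    (2 * s.time, .X s.q) :: (tof s.a s.b s.q).map fun g => (2 * s.time + 1, g)
  have hf : stepsCircuit S = (S.flatMap f).map Prod.snd := by
    rw [List.map_flatMap, stepsCircuit]
    congr 1
    funext s
    simp [f, Step.circuit, Function.comp_def]
  have hmem : ∀ s, ∀ p ∈ f s, (p.1 = 2 * s.time ∨ p.1 = 2 * s.time + 1) ∧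
      ∀ v ∈ p.2.support, s.Uses v := by
    intro s p hp
    simp only [f, List.mem_cons, List.mem_map] at hp
    rcases hp with rfl | ⟨g, hg, rfl⟩
    · exact ⟨Or.inl rfl, fun v hv => Or.inr (Or.inr (by simpa [Gate.support] using hv))⟩
    · refine ⟨Or.inr rfl, ?_⟩
      have := actsOn_tof (p := s.Uses) (Or.inl rfl) (Or.inr (Or.inl rfl)) (Or.inr (Or.inr rfl)) g hg
      exact this
  rw [hf]
  refine depthLE_of_times (fun p hp => ?_) (List.pairwise_flatMap.2 ⟨fun s _ => ?_, ?_⟩)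
  · obtain ⟨s, hs, hp⟩ := List.mem_flatMap.1 hp
    have h1 := (hmem s p hp).1
    have h2 := hT s hs
    omega
  · simp only [f, tof]
    split <;> simp
  · refine h.imp fun {s s'} hss p hp p' hp' ho => ?_
    obtain ⟨v, hv, hv'⟩ := Finset.not_disjoint_iff.1 ho
    have h1 := hss v ((hmem s p hp).2 v hv) ((hmem s' p' hp').2 v hv')
    have h2 := (hmem s p hp).1
    have h3 := (hmem s' p' hp').1
    omega

/-! ### The product of the controls in logarithmic depth -/

/-- The wire of node `j ≥ 1` of the binary tree with root `1`, in which the children of `j` are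
`2 * j` and `2 * j + 1`. -/
def treeWire (w L j : ℕ) : ℕ := w + 4 * L + 2 * j + 5

/-- The auxiliary control that holds the result of stage `i`. -/
def resWire (w i : ℕ) : ℕ := w + 4 * i + 3

/-- The auxiliary control that holds the product of the results of the stages from `i` on. -/
def accWire (w i : ℕ) : ℕ := w + 4 * i + 5

/-- The steps that multiply the nodes `≤ 2 * J + 1` of the tree into its root, by storing in the
nodes `J, …, 1` the products of their children. -/
def treeSteps (w L m : ℕ) : ℕ → List Step
  | 0 => []
  | J + 1 => ⟨2 * m - Nat.log 2 (J + 1), treeWire w L (2 * (J + 1)), treeWire w L (2 * (J + 1) + 1),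
      treeWire w L (J + 1)⟩ :: treeSteps w L m J

/-- The steps of the stages `m, …, m + r - 1`. The nodes of the tree are `1, …, 2 * K + 1`. Stage
`m` multiplies the nodes below level `m + 1` and the two controls `resWire w (m + 1)` and
`accWire w (m + 1)`, storing the result in `resWire w m`; after the later stages, the product of
their results is multiplied with the one of stage `m` and stored in `accWire w m`. The wire `w + 1`
holds an intermediate product. -/
def stageSteps (w L K : ℕ) : ℕ → ℕ → List Step
  | 0, _ => []
  | r + 1, m => treeSteps w L m (min (2 ^ m - 1) K) ++
      ⟨2 * m, resWire w (m + 1), accWire w (m + 1), w + 1⟩ ::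
      ⟨2 * m + 1, treeWire w L 1, w + 1, resWire w m⟩ ::
      (stageSteps w L K r (m + 1) ++
        [⟨3 * L - m, resWire w m, accWire w (m + 1), accWire w m⟩])

theorem mem_treeSteps {w L m J : ℕ} {s : Step} (hs : s ∈ treeSteps w L m J) :
    ∃ j, 1 ≤ j ∧ j ≤ J ∧ s = ⟨2 * m - Nat.log 2 j, treeWire w L (2 * j), treeWire w L (2 * j + 1),
      treeWire w L j⟩ := by
  induction J with
  | zero => simp [treeSteps] at hs
  | succ J ih =>
    rcases List.mem_cons.1 hs with rfl | hs
    · exact ⟨J + 1, by omega, le_rfl, rfl⟩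
    · obtain ⟨j, h1, h2, h3⟩ := ih hs
      exact ⟨j, h1, by omega, h3⟩

/-- The steps that are carried out before the results of the stages are multiplied, in the stages
`i` with `m ≤ i < m'`. -/
inductive ForwardStep (w L K m m' : ℕ) : Step → Prop
  | node (i j : ℕ) (hi : m ≤ i) (hi' : i < m') (hj : 1 ≤ j) (hj' : j < 2 ^ i) (hjK : j ≤ K) :
    ForwardStep w L K m m' ⟨2 * i - Nat.log 2 j, treeWire w L (2 * j), treeWire w L (2 * j + 1),
      treeWire w L j⟩
  | pair (i : ℕ) (hi : m ≤ i) (hi' : i < m') :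
    ForwardStep w L K m m' ⟨2 * i, resWire w (i + 1), accWire w (i + 1), w + 1⟩
  | join (i : ℕ) (hi : m ≤ i) (hi' : i < m') :
    ForwardStep w L K m m' ⟨2 * i + 1, treeWire w L 1, w + 1, resWire w i⟩

theorem ForwardStep.mono {w L K m m' n n' : ℕ} {s : Step} (h : ForwardStep w L K m m' s)
    (hm : n ≤ m) (hm' : m' ≤ n') : ForwardStep w L K n n' s := by
  cases h with
  | node i j hi hi' hj hj' hjK => exact .node i j (by omega) (by omega) hj hj' hjK
  | pair i hi hi' => exact .pair i (by omega) (by omega)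
  | join i hi hi' => exact .join i (by omega) (by omega)

theorem forwardStep_of_mem_treeSteps {w L K m : ℕ} {s : Step}
    (hs : s ∈ treeSteps w L m (min (2 ^ m - 1) K)) : ForwardStep w L K m (m + 1) s := by
  obtain ⟨j, h1, h2, rfl⟩ := mem_treeSteps hs
  exact .node m j le_rfl (by omega) h1 (by omega) (by omega)

theorem mem_stageSteps {w L K r m : ℕ} {s : Step} (hs : s ∈ stageSteps w L K r m) :
    ForwardStep w L K m (m + r) s ∨ ∃ i, m ≤ i ∧ i < m + r ∧
      s = ⟨3 * L - i, resWire w i, accWire w (i + 1), accWire w i⟩ := by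
  induction r generalizing m with
  | zero => simp [stageSteps] at hs
  | succ r ih =>
    simp only [stageSteps, List.mem_append, List.mem_cons, List.not_mem_nil, or_false] at hs
    rcases hs with hs | rfl | rfl | hs | rfl
    · exact Or.inl ((forwardStep_of_mem_treeSteps hs).mono le_rfl (by omega))
    · exact Or.inl (.pair m le_rfl (by omega))
    · exact Or.inl (.join m le_rfl (by omega))
    · rcases ih hs with h | ⟨i, h1, h2, h3⟩
      · exact Or.inl (h.mono (by omega) (by omega))
      · exact Or.inr ⟨i, by omega, by omega, h3⟩
    · exact Or.inr ⟨m, le_rfl, by omega, rfl⟩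

theorem target_of_mem_stageSteps {w L K r m : ℕ} {s : Step} (hs : s ∈ stageSteps w L K r m) :
    (∃ j, 1 ≤ j ∧ j ≤ K ∧ s.q = treeWire w L j) ∨ s.q = w + 1 ∨
      ∃ i, m ≤ i ∧ i < m + r ∧ (s.q = resWire w i ∨ s.q = accWire w i) := by
  rcases mem_stageSteps hs with h | ⟨i, h1, h2, rfl⟩
  · cases h with
    | node i j hi hi' hj hj' hjK => exact Or.inl ⟨j, hj, hjK, rfl⟩
    | pair i hi hi' => exact Or.inr (Or.inl rfl)
    | join i hi hi' => exact Or.inr (Or.inr ⟨i, hi, hi', Or.inl rfl⟩)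
  · exact Or.inr (Or.inr ⟨i, h1, h2, Or.inr rfl⟩)

/-- The wires of the steps are the `2 * K + 2 * L + 4` controls. -/
theorem uses_of_mem_stageSteps {w L K r m : ℕ} (hL : m + r ≤ L) {s : Step}
    (hs : s ∈ stageSteps w L K r m) {v : ℕ} (hv : s.Uses v) :
    ∃ i < 2 * K + 2 * L + 4, v = w + 2 * i + 1 := by
  unfold Step.Uses at hv
  rcases mem_stageSteps hs with h | ⟨i, h1, h2, rfl⟩
  · cases h with
    | node i j hi hi' hj hj' hjK =>
      simp only [treeWire] at hv
      exact ⟨(v - w - 1) / 2, by omega, by omega⟩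
    | pair i hi hi' =>
      simp only [resWire, accWire] at hv
      exact ⟨(v - w - 1) / 2, by omega, by omega⟩
    | join i hi hi' =>
      simp only [resWire, treeWire] at hv
      exact ⟨(v - w - 1) / 2, by omega, by omega⟩
  · simp only [resWire, accWire] at hv
    exact ⟨(v - w - 1) / 2, by omega, by omega⟩

theorem distinct_of_mem_stageSteps {w L K r m : ℕ} (hL : m + r ≤ L) {s : Step}
    (hs : s ∈ stageSteps w L K r m) : s.Distinct := by
  unfold Step.Distinct
  rcases mem_stageSteps hs with h | ⟨i, h1, h2, rfl⟩
  · cases h with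
    | node i j hi hi' hj hj' hjK => simp only [treeWire]; omega
    | pair i hi hi' => simp only [resWire, accWire]; omega
    | join i hi hi' => simp only [resWire, treeWire]; omega
  · simp only [resWire, accWire]; omega

/-- If the targets of the tree steps hold `1` before and the root holds `1` after these steps, then
all nodes hold `1` before and after them. -/
theorem treeSteps_infer {w L m J : ℕ} {x : ℕ → Bool}
    (hx : ∀ j, 1 ≤ j → j ≤ J → x (treeWire w L j) = true)
    (h : stepsRun (treeSteps w L m J) x (treeWire w L 1) = true) :
    ∀ j, 1 ≤ j → j ≤ 2 * J + 1 → x (treeWire w L j) = true ∧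
      stepsRun (treeSteps w L m J) x (treeWire w L j) = true := by
  induction J generalizing x with
  | zero =>
    intro j h1 h2
    obtain rfl : j = 1 := by omega
    exact ⟨h, h⟩
  | succ J ih =>
    set s : Step := ⟨2 * m - Nat.log 2 (J + 1), treeWire w L (2 * (J + 1)),
      treeWire w L (2 * (J + 1) + 1), treeWire w L (J + 1)⟩ with hs
    have hrun : stepsRun (treeSteps w L m (J + 1)) x = stepsRun (treeSteps w L m J) (s.act x) := rfl
    rw [hrun] at h ⊢
    have hne : ∀ v, v ≠ treeWire w L (J + 1) → s.act x v = x v := fun v hv =>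
      Function.update_of_ne hv _ _
    have hframe : ∀ j, J < j → stepsRun (treeSteps w L m J) (s.act x) (treeWire w L j) =
        s.act x (treeWire w L j) := by
      intro j hj
      refine stepsRun_apply_of_ne (fun t ht => ?_) _
      obtain ⟨i, h1, h2, rfl⟩ := mem_treeSteps ht
      simp only [treeWire]; omega
    have ih' := ih (x := s.act x) (fun j h1 h2 => by
      rw [hne _ (by simp only [treeWire]; omega)]; exact hx j h1 (by omega)) h
    have hq := hx (J + 1) (by omega) le_rfl
    obtain ⟨ha, hb⟩ := Step.controls_of_act (s := s) (x := x) hq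
      (ih' (J + 1) (by omega) (by omega)).1
    intro j h1 h2
    have hxj : x (treeWire w L j) = true := by
      rcases Nat.lt_or_ge (2 * J + 1) j with h3 | h3
      · rcases (by omega : j = 2 * (J + 1) ∨ j = 2 * (J + 1) + 1) with rfl | rfl
        exacts [ha, hb]
      · by_cases h4 : j = J + 1
        · rw [h4]; exact hq
        · rw [← hne _ (by simp only [treeWire]; omega)]
          exact (ih' j h1 h3).1
    refine ⟨hxj, ?_⟩
    rcases Nat.lt_or_ge (2 * J + 1) j with h3 | h3
    · rw [hframe j (by omega), hne _ (by simp only [treeWire]; omega), hxj]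
    · exact (ih' j h1 h3).2

/-- If the wires that are clean at the beginning of stage `m` hold `1` and the product of the
results of the stages from `m` on is `1`, then all controls hold `1`: the result of a stage being
`1` makes the wires that hold its other intermediate values clean for the next stage. -/
theorem stageSteps_infer {w L K : ℕ} (hK : 2 * K + 1 < 2 ^ L) {r m : ℕ} (hr : m + r = L)
    {x : ℕ → Bool} (htree : ∀ j, 1 ≤ j → j < 2 ^ m → j ≤ 2 * K + 1 → x (treeWire w L j) = true)
    (hB : x (w + 1) = true) (hR : x (resWire w m) = true) (hA : x (accWire w m) = true)
    (h : stepsRun (stageSteps w L K r m) x (accWire w m) = true) :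
    (∀ j, 1 ≤ j → j ≤ 2 * K + 1 → x (treeWire w L j) = true) ∧
      ∀ i, m < i → i ≤ L → x (resWire w i) = true ∧ x (accWire w i) = true := by
  induction r generalizing m x with
  | zero =>
    obtain rfl : m = L := by omega
    exact ⟨fun j h1 h2 => htree j h1 (by omega) h2, fun i h1 h2 => by omega⟩
  | succ r ih =>
    set J := min (2 ^ m - 1) K with hJ
    set s₁ : Step := ⟨2 * m, resWire w (m + 1), accWire w (m + 1), w + 1⟩ with hs₁
    set s₂ : Step := ⟨2 * m + 1, treeWire w L 1, w + 1, resWire w m⟩ with hs₂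
    set s₃ : Step := ⟨3 * L - m, resWire w m, accWire w (m + 1), accWire w m⟩ with hs₃
    set x₁ := stepsRun (treeSteps w L m J) x with hx₁
    set x₂ := s₁.act x₁ with hx₂
    set x₃ := s₂.act x₂ with hx₃
    set y := stepsRun (stageSteps w L K r (m + 1)) x₃ with hy
    have hrun : stepsRun (stageSteps w L K (r + 1) m) x = s₃.act y := by
      rw [stageSteps, stepsRun_append, stepsRun, stepsRun, stepsRun_append]
      rfl
    rw [hrun] at h
    have e₁ : ∀ v, (∀ j, 1 ≤ j → j ≤ J → v ≠ treeWire w L j) → x₁ v = x v := by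
      intro v hv
      refine stepsRun_apply_of_ne (fun t ht => ?_) _
      obtain ⟨j, h1, h2, rfl⟩ := mem_treeSteps ht
      exact (hv j h1 h2).symm
    have e₂ : ∀ v, v ≠ w + 1 → x₂ v = x₁ v := fun v hv => Function.update_of_ne hv _ _
    have e₃ : ∀ v, v ≠ resWire w m → x₃ v = x₂ v := fun v hv => Function.update_of_ne hv _ _
    have e₄ : ∀ v, v = resWire w m ∨ v = accWire w m → y v = x₃ v := by
      intro v hv
      refine stepsRun_apply_of_ne (fun t ht => ?_) _
      rcases target_of_mem_stageSteps ht with ⟨j, h1, h2, h3⟩ | h3 | ⟨i, h1, h2, h3⟩ <;>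
        simp only [treeWire, resWire, accWire] at h3 hv <;> omega
    have hyA : y (accWire w m) = true := by
      rw [e₄ _ (Or.inr rfl), e₃ _ (by simp only [resWire, accWire]; omega),
        e₂ _ (by simp only [accWire]; omega),
        e₁ _ fun j _ _ => by simp only [accWire, treeWire]; omega, hA]
    obtain ⟨hyR, hyA'⟩ := Step.controls_of_act (s := s₃) hyA h
    have hx₂R : x₂ (resWire w m) = true := by
      rw [e₂ _ (by simp only [resWire]; omega),
        e₁ _ fun j _ _ => by simp only [resWire, treeWire]; omega, hR]
    have hx₃R : x₃ (resWire w m) = true := by rw [← e₄ _ (Or.inl rfl)]; exact hyR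
    obtain ⟨hroot, hx₂B⟩ := Step.controls_of_act (s := s₂) hx₂R hx₃R
    have hx₁B : x₁ (w + 1) = true := by
      rw [e₁ _ fun j _ _ => by simp only [treeWire]; omega, hB]
    obtain ⟨hx₁R, hx₁A⟩ := Step.controls_of_act (s := s₁) hx₁B hx₂B
    have hroot' : x₁ (treeWire w L 1) = true := by
      rw [← e₂ _ (by simp only [treeWire]; omega)]; exact hroot
    have hnodes := treeSteps_infer (fun j h1 h2 => htree j h1 (by omega) (by omega)) hroot'
    have e₃₁ : ∀ v, v ≠ w + 1 → v ≠ resWire w m → x₃ v = x₁ v := fun v h1 h2 => by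
      rw [e₃ v h2, e₂ v h1]
    have hpow : 2 ^ (m + 1) = 2 * 2 ^ m := by rw [pow_succ]; ring
    obtain ⟨it, ig⟩ := ih (m := m + 1) (x := x₃) (by omega)
      (fun j h1 h2 h3 => by
        rw [e₃₁ _ (by simp only [treeWire]; omega) (by simp only [treeWire, resWire]; omega)]
        exact (hnodes j h1 (by omega)).2)
      (by rw [e₃ _ (by simp only [resWire]; omega)]; exact hx₂B)
      (by rw [e₃₁ _ (by simp only [resWire]; omega) (by simp only [resWire]; omega)]; exact hx₁R)
      (by
        rw [e₃₁ _ (by simp only [accWire]; omega) (by simp only [accWire, resWire]; omega)]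
        exact hx₁A)
      hyA'
    have eg : ∀ i, m < i → i ≤ L →
        x₁ (resWire w i) = x (resWire w i) ∧ x₁ (accWire w i) = x (accWire w i) := fun i h1 h2 =>
      ⟨e₁ _ fun j _ _ => by simp only [resWire, treeWire]; omega,
        e₁ _ fun j _ _ => by simp only [accWire, treeWire]; omega⟩
    refine ⟨fun j h1 h2 => ?_, fun i h1 h2 => ?_⟩
    · by_cases h3 : j ≤ 2 * J + 1
      · exact (hnodes j h1 h3).1
      · have := it j h1 h2
        rw [e₃₁ _ (by simp only [treeWire]; omega) (by simp only [treeWire, resWire]; omega),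
          e₁ _ fun i _ _ => by simp only [treeWire]; omega] at this
        exact this
    · rw [← (eg i h1 h2).1, ← (eg i h1 h2).2]
      by_cases h3 : i = m + 1
      · rw [h3]; exact ⟨hx₁R, hx₁A⟩
      · have := ig i (by omega) h2
        rwa [e₃₁ _ (by simp only [resWire]; omega) (by simp only [resWire]; omega),
          e₃₁ _ (by simp only [accWire]; omega) (by simp only [accWire, resWire]; omega)] at this

/-! ### Times of the steps -/

theorem log_le_of_treeWire_share {w L j j' v : ℕ} (hj : 1 ≤ j) (hj' : 1 ≤ j')
    (h : v = treeWire w L (2 * j) ∨ v = treeWire w L (2 * j + 1) ∨ v = treeWire w L j)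
    (h' : v = treeWire w L (2 * j') ∨ v = treeWire w L (2 * j' + 1) ∨ v = treeWire w L j') :
    Nat.log 2 j' ≤ Nat.log 2 j + 1 ∧ (j' < j → Nat.log 2 j = Nat.log 2 j' + 1) := by
  have hlog : ∀ i, 1 ≤ i → Nat.log 2 (2 * i) = Nat.log 2 i + 1 ∧
      Nat.log 2 (2 * i + 1) = Nat.log 2 i + 1 := by
    intro i hi
    have h1 := Nat.log_of_one_lt_of_le one_lt_two (show 2 ≤ 2 * i by omega)
    have h2 := Nat.log_of_one_lt_of_le one_lt_two (show 2 ≤ 2 * i + 1 by omega)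
    rw [show 2 * i / 2 = i by omega] at h1
    rw [show (2 * i + 1) / 2 = i by omega] at h2
    exact ⟨h1, h2⟩
  simp only [treeWire] at h h'
  have hcases : j = j' ∨ j = 2 * j' ∨ j = 2 * j' + 1 ∨ j' = 2 * j ∨ j' = 2 * j + 1 := by omega
  have h1 := hlog j hj
  have h2 := hlog j' hj'
  rcases hcases with e | e | e | e | e
  · rw [e]; omega
  · rw [e, h2.1]; omega
  · rw [e, h2.2]; omega
  · rw [e, h1.1]; omega
  · rw [e, h1.2]; omega

theorem pairwise_treeSteps (w L m J : ℕ) (hJ : J < 2 ^ m) :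
    (treeSteps w L m J).Pairwise fun s s' => ∀ v, s.Uses v → s'.Uses v → s.time < s'.time := by
  induction J with
  | zero => exact List.Pairwise.nil
  | succ J ih =>
    refine List.pairwise_cons.2 ⟨fun s' hs' v hv hv' => ?_, ih (by omega)⟩
    obtain ⟨j, h1, h2, rfl⟩ := mem_treeSteps hs'
    have := (log_le_of_treeWire_share (by omega) h1 hv hv').2 (by omega)
    have h3 : Nat.log 2 (J + 1) < m := Nat.log_lt_of_lt_pow (by omega) hJ
    simp only
    omega

theorem ForwardStep.time_lt {w L K m n n' : ℕ} {s s' : Step}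
    (h : ForwardStep w L K m (m + 1) s) (h' : ForwardStep w L K n n' s') (hmn : m < n)
    (hL : m < L) {v : ℕ} (hv : s.Uses v) (hv' : s'.Uses v) : s.time < s'.time := by
  have hlt : ∀ {i j : ℕ}, 1 ≤ j → j < 2 ^ i → Nat.log 2 j < i := fun h1 h2 =>
    Nat.log_lt_of_lt_pow (by omega) h2
  cases h with
  | node i j hi hi' hj hj' hjK =>
    have h1 := hlt hj hj'
    cases h' with
    | node k l hk hk' hl hl' hlK =>
      have h2 := hlt hl hl'
      have h3 := (log_le_of_treeWire_share hj hl hv hv').1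
      simp only
      omega
    | pair k hk hk' => simp only; omega
    | join k hk hk' => simp only; omega
  | pair i hi hi' =>
    cases h' with
    | node k l hk hk' hl hl' hlK =>
      have h2 := hlt hl hl'
      simp only [Step.Uses, treeWire, resWire, accWire] at hv hv'
      omega
    | pair k hk hk' => simp only; omega
    | join k hk hk' => simp only; omega
  | join i hi hi' =>
    cases h' with
    | node k l hk hk' hl hl' hlK =>
      have h2 := hlt hl hl'
      have hl1 : l = 1 := by
        simp only [Step.Uses, treeWire, resWire] at hv hv'
        omega
      subst hl1
      simp only [Nat.log_one_right]
      omega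
    | pair k hk hk' => simp only; omega
    | join k hk hk' => simp only; omega

theorem ForwardStep.time_le {w L K m m' : ℕ} {s : Step} (h : ForwardStep w L K m m' s) :
    s.time + 1 ≤ 2 * m' := by
  cases h <;> simp only <;> omega

theorem pairwise_stageSteps {w L K r m : ℕ} (hL : m + r ≤ L) :
    (stageSteps w L K r m).Pairwise
      fun s s' => ∀ v, s.Uses v → s'.Uses v → s.time < s'.time := by
  induction r generalizing m with
  | zero => exact List.Pairwise.nil
  | succ r ih =>
    -- the steps of stage `m` that precede the later stages
    have hlater : ∀ {s}, ForwardStep w L K m (m + 1) s → ∀ s' ∈ stageSteps w L K r (m + 1) ++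
        [(⟨3 * L - m, resWire w m, accWire w (m + 1), accWire w m⟩ : Step)],
        ∀ v, s.Uses v → s'.Uses v → s.time < s'.time := by
      intro s hs s' hs' v hv hv'
      have h1 := hs.time_le
      rcases List.mem_append.1 hs' with hs' | hs'
      · rcases mem_stageSteps hs' with h | ⟨i, h2, h3, rfl⟩
        · exact hs.time_lt h (Nat.lt_succ_self m) (by omega) hv hv'
        · simp only; omega
      · rw [List.mem_singleton] at hs'
        subst hs'
        simp only; omega
    have hpair : ForwardStep w L K m (m + 1)
        ⟨2 * m, resWire w (m + 1), accWire w (m + 1), w + 1⟩ := .pair m le_rfl (by omega)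
    have hjoin : ForwardStep w L K m (m + 1)
        ⟨2 * m + 1, treeWire w L 1, w + 1, resWire w m⟩ := .join m le_rfl (by omega)
    rw [stageSteps, List.pairwise_append]
    have hpos : 0 < 2 ^ m := by positivity
    refine ⟨pairwise_treeSteps _ _ _ _ (by omega), ?_, ?_⟩
    · refine List.pairwise_cons.2 ⟨?_, List.pairwise_cons.2 ⟨hlater hjoin, ?_⟩⟩
      · intro s' hs' v hv hv'
        rcases List.mem_cons.1 hs' with rfl | hs'
        · simp only; omega
        · exact hlater hpair s' hs' v hv hv'
      · rw [List.pairwise_append]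
        refine ⟨ih (by omega), List.pairwise_singleton _ _, fun s hs s' hs' v _ _ => ?_⟩
        rw [List.mem_singleton] at hs'
        subst hs'
        rcases mem_stageSteps hs with h | ⟨i, h2, h3, rfl⟩
        · have := h.time_le
          simp only; omega
        · simp only; omega
    · intro s hs s' hs' v hv hv'
      have hs1 := forwardStep_of_mem_treeSteps hs
      rcases List.mem_cons.1 hs' with rfl | hs'
      · obtain ⟨j, h1, h2, rfl⟩ := mem_treeSteps hs
        simp only [Step.Uses, treeWire, resWire, accWire] at hv hv'
        omega
      · rcases List.mem_cons.1 hs' with rfl | hs'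
        · obtain ⟨j, h1, h2, rfl⟩ := mem_treeSteps hs
          simp only; omega
        · exact hlater hs1 s' hs' v hv hv'

theorem depthLE_stageSteps (w L K : ℕ) :
    DepthLE (stepsCircuit (stageSteps w L K L 0)) (2 * (3 * L + 1)) := by
  refine depthLE_stepsCircuit (fun s hs => ?_) (pairwise_stageSteps (by omega))
  rcases mem_stageSteps hs with h | ⟨i, h2, h3, rfl⟩
  · have := h.time_le
    omega
  · simp only; omega

theorem length_treeSteps (w L m J : ℕ) : (treeSteps w L m J).length = J := by
  induction J with
  | zero => rfl
  | succ J ih => simp [treeSteps, ih]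

theorem length_stageSteps_le (w L K r m : ℕ) :
    (stageSteps w L K r m).length + 2 ^ m ≤ 2 ^ (m + r) + 3 * r := by
  induction r generalizing m with
  | zero => simp [stageSteps]
  | succ r ih =>
    have h1 := ih (m + 1)
    have h2 : min (2 ^ m - 1) K + 1 ≤ 2 ^ m := by
      have : 0 < 2 ^ m := by positivity
      omega
    have h3 : 2 ^ (m + 1) = 2 * 2 ^ m := by rw [pow_succ]; ring
    rw [show m + 1 + r = m + (r + 1) by ring] at h1
    simp only [stageSteps, List.length_append, List.length_cons, length_treeSteps,
      List.length_nil]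
    omega

/-! ### The multiply controlled gate of a block -/

/-- The product of the controls of a block: the wires `w + 1, w + 3, …, w + 2 * k - 1` all hold
`1`. -/
def allOnes (w k : ℕ) (x : ℕ → Bool) : Bool := decide (∀ i < k, x (w + 2 * i + 1) = true)

/-- The steps that multiply the controls of a block of `2 ^ l` bits, `l ≥ 4`. The
number of internal nodes of the tree is such that `stageSteps` has `2 ^ l` controls. -/
def prodSteps (w l : ℕ) : List Step := stageSteps w l (2 ^ (l - 1) - l - 2) l 0

theorem two_pow_eq {l : ℕ} (hl : 4 ≤ l) :
    2 ^ l = 2 * 2 ^ (l - 1) ∧ l + 2 ≤ 2 ^ (l - 1) := by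
  obtain ⟨n, rfl⟩ := Nat.exists_eq_add_of_le hl
  have h1 : n < 2 ^ n := Nat.lt_two_pow_self
  rw [show 4 + n - 1 = n + 3 by omega, show 4 + n = n + 3 + 1 by ring]
  constructor
  · rw [pow_succ]; ring
  · rw [pow_add]; omega

theorem uses_prodSteps {w l : ℕ} (hl : 4 ≤ l) {s : Step} (hs : s ∈ prodSteps w l) {v : ℕ}
    (hv : s.Uses v) : ∃ i < 2 ^ l, v = w + 2 * i + 1 := by
  obtain ⟨h1, h2⟩ := two_pow_eq hl
  obtain ⟨i, h3, h4⟩ := uses_of_mem_stageSteps (by omega) hs hv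
  exact ⟨i, by omega, h4⟩

theorem actsOn_prodSteps {w l : ℕ} (hl : 4 ≤ l) :
    ActsOn (stepsCircuit (prodSteps w l)) fun v => ∃ i < 2 ^ l, v = w + 2 * i + 1 :=
  actsOn_stepsCircuit fun _ hs _ hv => uses_prodSteps hl hs hv

theorem run_prodSteps (w : ℕ) {l : ℕ} (x : ℕ → Bool) :
    run (stepsCircuit (prodSteps w l)) x = stepsRun (prodSteps w l) x :=
  run_stepsCircuit (fun _ hs => distinct_of_mem_stageSteps (by omega) hs) x

/-- Provided that the three wires that are clean at the outset hold `1`, the steps produce the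
product of all controls. Without this proviso their result is arbitrary. -/
theorem clean_and_prodSteps {w l : ℕ} (hl : 4 ≤ l) (x : ℕ → Bool) :
    ((x (w + 1) && (x (w + 3) && x (w + 5))) && stepsRun (prodSteps w l) x (w + 5)) =
      allOnes w (2 ^ l) x := by
  obtain ⟨h1, h2⟩ := two_pow_eq hl
  rw [Bool.eq_iff_iff]
  simp only [Bool.and_eq_true, allOnes, decide_eq_true_eq]
  constructor
  · rintro ⟨⟨hB, hR, hA⟩, h⟩ i hi
    obtain ⟨ht, hg⟩ := stageSteps_infer (w := w) (K := 2 ^ (l - 1) - l - 2) (r := l) (m := 0)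
      (by omega) (by omega) (fun j h3 h4 => by simp at h4; omega) hB hR hA h
    rcases Nat.lt_or_ge i (2 * l + 3) with h3 | h3
    · rcases Nat.even_or_odd' i with ⟨j, rfl | rfl⟩
      · rcases Nat.lt_or_ge j 2 with h4 | h4
        · interval_cases j
          exacts [hB, hA]
        · have := (hg (j - 1) (by omega) (by omega)).2
          rwa [accWire, show w + 4 * (j - 1) + 5 = w + 2 * (2 * j) + 1 by omega] at this
      · rcases Nat.eq_zero_or_pos j with rfl | h4
        · exact hR
        · have := (hg j h4 (by omega)).1
          rwa [resWire, show w + 4 * j + 3 = w + 2 * (2 * j + 1) + 1 by omega] at this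
    · have := ht (i - 2 * l - 2) (by omega) (by omega)
      rwa [treeWire, show w + 4 * l + 2 * (i - 2 * l - 2) + 5 = w + 2 * i + 1 by omega] at this
  · intro h
    have hB := h 0 (by omega)
    have hR := h 1 (by omega)
    have hA := h 2 (by omega)
    refine ⟨⟨hB, hR, hA⟩, ?_⟩
    rw [stepsRun_eq_self]
    · exact hA
    · intro s hs
      have key : ∀ v, s.Uses v → x v = true := by
        intro v hv
        obtain ⟨i, hi, rfl⟩ := uses_prodSteps hl hs hv
        exact h i hi
      exact ⟨key _ (Or.inl rfl), key _ (Or.inr (Or.inl rfl)), key _ (Or.inr (Or.inr rfl))⟩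

/-- XORs the product of `w`, `w + 2` and the result of `prodSteps w l` onto `w + 2 * 2 ^ l`. -/
def prodXor (w l : ℕ) : Circuit ℕ :=
  stepsCircuit (prodSteps w l) ++ smallMCX [w, w + 2, w + 5] [w + 4] (w + 2 * 2 ^ l) ++
    (stepsCircuit (prodSteps w l)).reverse

/-- The multiply controlled gate of a block of `2 ^ l` bits with `l ≥ 4`, which has enough
controls for the stages of `prodSteps`. The wire `w + 2`, whose
content is arbitrary, is toggled by the product of the three wires that `prodSteps` takes to be
clean, and later toggled back; as `prodXor` is carried out both in the toggled and in the original
state of this wire, the contributions in which this product does not occur cancel. -/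
def largeMCX (w l : ℕ) : Circuit ℕ :=
  (smallMCX [w + 1, w + 3, w + 5] [w + 4] (w + 2) ++ prodXor w l) ++
    (smallMCX [w + 1, w + 3, w + 5] [w + 4] (w + 2) ++ prodXor w l)

theorem stepsRun_prodSteps_update {w l : ℕ} (hl : 4 ≤ l) {v : ℕ}
    (hv : ∀ i < 2 ^ l, v ≠ w + 2 * i + 1) (x : ℕ → Bool) (u : Bool) :
    stepsRun (prodSteps w l) (Function.update x v u) =
      Function.update (stepsRun (prodSteps w l) x) v u := by
  rw [← run_prodSteps, ← run_prodSteps]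
  exact run_update ((actsOn_prodSteps hl).notMem fun ⟨i, hi, h⟩ => hv i hi h) x u

theorem stepsRun_prodSteps_apply {w l : ℕ} (hl : 4 ≤ l) {v : ℕ}
    (hv : ∀ i < 2 ^ l, v ≠ w + 2 * i + 1) (x : ℕ → Bool) :
    stepsRun (prodSteps w l) x v = x v := by
  rw [← run_prodSteps]
  exact (actsOn_prodSteps hl).run_apply (fun ⟨i, hi, h⟩ => hv i hi h) x

theorem run_prodXor {w l : ℕ} (hl : 4 ≤ l) (x : ℕ → Bool) :
    run (prodXor w l) x = Function.update x (w + 2 * 2 ^ l) (x (w + 2 * 2 ^ l) ^^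
      (x w && (x (w + 2) && stepsRun (prodSteps w l) x (w + 5)))) := by
  obtain ⟨h1, h2⟩ := two_pow_eq hl
  have hnd : ((w + 2 * 2 ^ l) :: ([w, w + 2, w + 5] ++ [w + 4])).Nodup := by
    simp; omega
  rw [prodXor, run_append, run_append, run_prodSteps, run_smallMCX _ _ _ (by simp) hnd]
  refine run_reverse_of_run_eq ?_
  have e : ∀ v, (∀ i < 2 ^ l, v ≠ w + 2 * i + 1) → stepsRun (prodSteps w l) x v = x v :=
    fun v hv => stepsRun_prodSteps_apply hl hv x
  rw [run_prodSteps, stepsRun_prodSteps_update hl (fun i _ => by omega)]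
  simp only [List.all_cons, List.all_nil, Bool.and_true]
  rw [e w fun i _ => by omega, e (w + 2) fun i _ => by omega,
    e (w + 2 * 2 ^ l) fun i _ => by omega]

theorem run_largeMCX {w l : ℕ} (hl : 4 ≤ l) (x : ℕ → Bool) :
    run (largeMCX w l) x = Function.update x (w + 2 * 2 ^ l)
      (x (w + 2 * 2 ^ l) ^^ (x w && allOnes w (2 ^ l) x)) := by
  obtain ⟨h1, h2⟩ := two_pow_eq hl
  have hnd : ((w + 2) :: ([w + 1, w + 3, w + 5] ++ [w + 4])).Nodup := by simp
  have hc : ∀ y, run (smallMCX [w + 1, w + 3, w + 5] [w + 4] (w + 2)) y =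
      Function.update y (w + 2) (y (w + 2) ^^ (y (w + 1) && (y (w + 3) && y (w + 5)))) := by
    intro y
    rw [run_smallMCX _ _ _ (by simp) hnd]
    simp
  rw [← clean_and_prodSteps hl]
  obtain ⟨t, ht⟩ : ∃ t, t = w + 2 * 2 ^ l := ⟨_, rfl⟩
  simp only [largeMCX, run_append, hc, run_prodXor hl, ← ht]
  have n2 : ∀ i < 2 ^ l, w + 2 ≠ w + 2 * i + 1 := fun i _ => by omega
  have nt : ∀ i < 2 ^ l, t ≠ w + 2 * i + 1 := fun i _ => by omega
  have d1 : t ≠ w + 2 := by omega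
  have d2 : t ≠ w + 1 := by omega
  have d3 : t ≠ w + 3 := by omega
  have d4 : t ≠ w + 5 := by omega
  have d5 : t ≠ w := by omega
  simp only [stepsRun_prodSteps_update hl n2, stepsRun_prodSteps_update hl nt]
  ext v
  by_cases hv : v = t
  · subst hv
    simp [d1, Ne.symm d1, Ne.symm d2, Ne.symm d3,
      Ne.symm d4, Ne.symm d5]
    cases x w <;> cases x (w + 1) <;> cases x (w + 3) <;> cases x (w + 5) <;>
      cases x (w + 2) <;> cases stepsRun (prodSteps w l) x (w + 5) <;> cases x v <;> rfl
  · by_cases hv2 : v = w + 2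
    · subst hv2
      simp [Function.update_apply, Ne.symm d1, Ne.symm d2, Ne.symm d3, Ne.symm d4]
    · simp [Function.update_apply, hv, hv2]

/-- The gate that XORs the product of the wire `w` and of the controls `w + 1, w + 3, …` of a block
of `2 ^ l` bits onto the wire `w + 2 * 2 ^ l`. -/
def blockMCX (l s : ℕ) : Circuit ℕ :=
  if l < 4 then
    smallMCX (2 * s :: (List.range (2 ^ l)).map fun i => 2 * s + 2 * i + 1)
      ((List.range (2 ^ l - 1)).map fun i => 2 * s + 2 * i + 2) (2 * (s + 2 ^ l))
  else largeMCX (2 * s) l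

theorem run_blockMCX (l s : ℕ) (x : ℕ → Bool) :
    run (blockMCX l s) x = Function.update x (2 * (s + 2 ^ l))
      (x (2 * (s + 2 ^ l)) ^^ (x (2 * s) && allOnes (2 * s) (2 ^ l) x)) := by
  have hpos : 0 < 2 ^ l := by positivity
  unfold blockMCX
  split
  · rw [run_smallMCX]
    · congr 2
      simp only [List.all_cons]
      congr 1
      rw [Bool.eq_iff_iff]
      simp [allOnes]
    · simp; omega
    · have hinj : ∀ c : ℕ, Function.Injective fun i => 2 * s + 2 * i + c := fun c i j h => by
        simp only at h; omega
      rw [List.nodup_cons, List.nodup_append, List.nodup_cons]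
      refine ⟨?_, ⟨?_, List.nodup_range.map (hinj 1)⟩, List.nodup_range.map (hinj 2), ?_⟩
      · simp only [List.cons_append, List.mem_cons, List.mem_append, List.mem_map, List.mem_range]
        rintro (h | ⟨i, h1, h2⟩ | ⟨i, h1, h2⟩) <;> omega
      · simp only [List.mem_map, List.mem_range]
        rintro ⟨i, h1, h2⟩; omega
      · simp only [List.mem_cons, List.mem_map, List.mem_range]
        rintro a (rfl | ⟨i, h1, rfl⟩) b ⟨j, h3, rfl⟩ <;> omega
  · rw [run_largeMCX (by omega), mul_add]

theorem actsOn_blockMCX (l s : ℕ) :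
    ActsOn (blockMCX l s) fun v => 2 * s ≤ v ∧ v ≤ 2 * (s + 2 ^ l) := by
  have hpos : 0 < 2 ^ l := by positivity
  unfold blockMCX
  split
  · refine actsOn_smallMCX _ _ _ ?_ ?_ ?_
    · simp only [List.mem_cons, List.mem_map, List.mem_range]
      rintro c (rfl | ⟨i, h1, rfl⟩) <;> omega
    · simp only [List.mem_map, List.mem_range]
      rintro c ⟨i, h1, rfl⟩
      omega
    · omega
  · obtain ⟨h1, h2⟩ := two_pow_eq (l := l) (by omega)
    have hc : ActsOn (smallMCX [2 * s + 1, 2 * s + 3, 2 * s + 5] [2 * s + 4] (2 * s + 2))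
        fun v => 2 * s ≤ v ∧ v ≤ 2 * (s + 2 ^ l) := by
      refine actsOn_smallMCX _ _ _ ?_ ?_ (by omega) <;> simp <;> omega
    have ht : ActsOn (smallMCX [2 * s, 2 * s + 2, 2 * s + 5] [2 * s + 4] (2 * s + 2 * 2 ^ l))
        fun v => 2 * s ≤ v ∧ v ≤ 2 * (s + 2 ^ l) := by
      refine actsOn_smallMCX _ _ _ ?_ ?_ (by omega) <;> simp <;> omega
    have hP : ActsOn (stepsCircuit (prodSteps (2 * s) l))
        fun v => 2 * s ≤ v ∧ v ≤ 2 * (s + 2 ^ l) :=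
      (actsOn_prodSteps (by omega)).mono fun v ⟨i, h3, h4⟩ => by omega
    have := hc.append ((hP.append ht).append hP.reverse)
    exact this.append this

theorem length_smallMCX_three_le (a b c d t : ℕ) : (smallMCX [a, b, c] [d] t).length ≤ 4 := by
  have h1 := length_tof_le a d t
  have h2 := length_tof_le b c d
  simp only [smallMCX, List.length_append]
  omega

theorem length_blockMCX_le (l s : ℕ) : (blockMCX l s).length ≤ 2048 * 2 ^ l := by
  unfold blockMCX
  split
  -- a small block has at most nine controls, and `4 * 2 ^ 9 = 2048`
  · refine (Nat.le_of_add_right_le (length_smallMCX_le _ _ _)).trans ?_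
    simp only [List.length_cons, List.length_map, List.length_range]
    interval_cases l <;> norm_num
  · have h1 := length_stepsCircuit_le (prodSteps (2 * s) l)
    have h2 := length_stageSteps_le (2 * s) l (2 ^ (l - 1) - l - 2) l 0
    have h3 := length_smallMCX_three_le (2 * s + 1) (2 * s + 3) (2 * s + 5) (2 * s + 4) (2 * s + 2)
    have h4 := length_smallMCX_three_le (2 * s) (2 * s + 2) (2 * s + 5) (2 * s + 4)
      (2 * s + 2 * 2 ^ l)
    have h5 : l < 2 ^ l := Nat.lt_two_pow_self
    rw [Nat.zero_add] at h2
    simp only [largeMCX, prodXor, List.length_append, List.length_reverse]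
    rw [prodSteps] at h1 ⊢
    omega

theorem depthLE_blockMCX (l s : ℕ) : DepthLE (blockMCX l s) (16384 * (l + 1)) := by
  rcases Nat.lt_or_ge l 4 with hl | hl
  -- the depth of a small block is at most its number of gates, `2048 * 2 ^ 3 = 16384`
  · refine (depthLE_length _).mono ((length_blockMCX_le l s).trans ?_)
    interval_cases l <;> norm_num
  · have hP : DepthLE (stepsCircuit (prodSteps (2 * s) l)) (2 * (3 * l + 1)) :=
      depthLE_stageSteps _ _ _
    have h3 := (depthLE_length _).mono (length_smallMCX_three_le (2 * s + 1) (2 * s + 3) (2 * s + 5)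
      (2 * s + 4) (2 * s + 2))
    have h4 := (depthLE_length _).mono (length_smallMCX_three_le (2 * s) (2 * s + 2) (2 * s + 5)
      (2 * s + 4) (2 * s + 2 * 2 ^ l))
    have h5 := h3.append ((hP.append h4).append hP.reverse)
    rw [blockMCX, if_neg (by omega)]
    exact (h5.append h5).mono (by omega)

/-! ### Ladders -/

/-- A family of circuits `U l s`, acting on the bits `s, …, s + 2 ^ l` of the first register and
`s, …, s + 2 ^ l - 1` of the second, that XOR the product of bit `s` of the first register
and of a function `β l s` of the second register onto bit `s + 2 ^ l` of the first. The function for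
a block is the product of those for its halves. -/
structure IsBlockFamily (U : ℕ → ℕ → Circuit ℕ) (β : ℕ → ℕ → (ℕ → Bool) → Bool) : Prop where
  run_eq : ∀ l s x, run (U l s) x = Function.update x (2 * (s + 2 ^ l))
    (x (2 * (s + 2 ^ l)) ^^ (x (2 * s) && β l s x))
  congr : ∀ l s x y, (∀ i, x (2 * i + 1) = y (2 * i + 1)) → β l s x = β l s y
  merge : ∀ l s x, β (l + 1) s x = (β l s x && β l (s + 2 ^ l) x)
  actsOn : ∀ l s, ActsOn (U l s) fun v => 2 * s ≤ v ∧ v ≤ 2 * (s + 2 ^ l)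

theorem isBlockFamily_blockMCX :
    IsBlockFamily blockMCX fun l s x => allOnes (2 * s) (2 ^ l) x where
  run_eq := run_blockMCX
  actsOn := actsOn_blockMCX
  congr l s x y h := by
    unfold allOnes
    congr 1
    refine propext (forall₂_congr fun i _ => ?_)
    rw [← mul_add, h]
  merge l s x := by
    rw [Bool.eq_iff_iff]
    simp only [allOnes, Bool.and_eq_true, decide_eq_true_eq]
    constructor
    · refine fun h => ⟨fun i hi => h i (by rw [pow_succ]; omega), fun i hi => ?_⟩
      rw [← h (2 ^ l + i) (by rw [pow_succ]; omega)]
      congr 1; ring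
    · rintro ⟨h1, h2⟩ i hi
      rw [pow_succ] at hi
      rcases Nat.lt_or_ge i (2 ^ l) with h3 | h3
      · exact h1 i h3
      · rw [← h2 (i - 2 ^ l) (by omega)]
        congr 1; omega

theorem isBlockFamily_cnot :
    IsBlockFamily (fun l s => cnot (2 * s) (2 * (s + 2 ^ l))) fun _ _ _ => true where
  run_eq l s x := by
    have : 0 < 2 ^ l := by positivity
    rw [run_cnot (by omega), Bool.and_true]
  congr _ _ _ _ _ := rfl
  merge _ _ _ := rfl
  actsOn l s :=
    have : 0 < 2 ^ l := by positivity
    actsOn_cnot ⟨le_rfl, by omega⟩ ⟨by omega, le_rfl⟩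

/-- The ladder that replaces bit `i + 1` of the first register, for `i = 0, …, n - 1` in this
order, by its sum with the product of bit `i` and of a function of the second register, restricted
to the bits whose positions are multiples of `2 ^ l`. The blocks in odd places are carried out
first, so that the bits whose positions are multiples of `2 ^ (l + 1)` satisfy a ladder of their
own; then the blocks in even places yield the other bits. The first argument bounds the depth of
the recursion. -/
def ladder (U : ℕ → ℕ → Circuit ℕ) (n : ℕ) : ℕ → ℕ → Circuit ℕ
  | 0, _ => []
  | f + 1, l => ((List.range (n / 2 ^ l / 2)).flatMap fun i => U l ((2 * i + 1) * 2 ^ l)) ++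
      ladder U n f (l + 1) ++
      ((List.range ((n / 2 ^ l + 1) / 2)).flatMap fun i => U l (2 * i * 2 ^ l))

section Ladder

variable {U : ℕ → ℕ → Circuit ℕ} {β : ℕ → ℕ → (ℕ → Bool) → Bool}

/-- The action of a parallel layer of blocks. -/
theorem IsBlockFamily.run_flatMap (hU : IsBlockFamily U β) {l : ℕ} {s : ℕ → ℕ}
    (hinj : ∀ i j, s i = s j → i = j) (hs : ∀ i j, s i ≠ s j + 2 ^ l) (N : ℕ) (x : ℕ → Bool) :
    (∀ v, (∀ i < N, v ≠ 2 * (s i + 2 ^ l)) →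
        run ((List.range N).flatMap fun i => U l (s i)) x v = x v) ∧
      ∀ i < N, run ((List.range N).flatMap fun i => U l (s i)) x (2 * (s i + 2 ^ l)) =
        (x (2 * (s i + 2 ^ l)) ^^ (x (2 * s i) && β l (s i) x)) := by
  induction N with
  | zero => simp
  | succ N ih =>
    rw [List.range_succ, List.flatMap_append, run_append]
    simp only [List.flatMap_cons, List.flatMap_nil, List.append_nil]
    rw [hU.run_eq]
    set y := run ((List.range N).flatMap fun i => U l (s i)) x with hy
    refine ⟨fun v hv => ?_, fun i hi => ?_⟩
    · rw [Function.update_of_ne (hv N (Nat.lt_succ_self N))]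
      exact ih.1 v fun i hi => hv i (by omega)
    · by_cases h : i = N
      · subst h
        rw [Function.update_self, ih.1 _ fun j hj => ?_, ih.1 _ fun j hj => ?_,
          hU.congr l (s i) y x fun j => ih.1 _ fun j hj => by omega]
        · have := hs i j; omega
        · intro h2
          have := hinj i j (by omega)
          omega
      · rw [Function.update_of_ne]
        · exact ih.2 i (by omega)
        · intro h2
          exact h (hinj i N (by omega))

theorem IsBlockFamily.run_ladder (hU : IsBlockFamily U β) (n f l : ℕ) (hf : n < 2 ^ (l + f))
    (x : ℕ → Bool) :
    (∀ v, (∀ j < n / 2 ^ l, v ≠ 2 * ((j + 1) * 2 ^ l)) → run (ladder U n f l) x v = x v) ∧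
      ∀ j < n / 2 ^ l, run (ladder U n f l) x (2 * ((j + 1) * 2 ^ l)) =
        (x (2 * ((j + 1) * 2 ^ l)) ^^
          (run (ladder U n f l) x (2 * (j * 2 ^ l)) && β l (j * 2 ^ l) x)) := by
  induction f generalizing l x with
  | zero =>
    rw [Nat.add_zero] at hf
    simp [ladder, Nat.div_eq_of_lt hf]
  | succ f ih =>
    set k := 2 ^ l with hk
    have hkpos : 0 < k := by positivity
    set M := n / k with hM
    have hM' : n / 2 ^ (l + 1) = M / 2 := by rw [pow_succ, ← Nat.div_div_eq_div_mul]
    have hne : ∀ i j : ℕ, i ≠ j → 2 * (i * k) ≠ 2 * (j * k) := fun i j hij h =>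
      hij (Nat.eq_of_mul_eq_mul_right hkpos (by omega))
    have hodd : ∀ i j : ℕ, 2 * i + 1 ≠ 2 * (j * k) := fun i j => by omega
    obtain ⟨a1, a2⟩ := hU.run_flatMap (l := l) (s := fun i => (2 * i + 1) * k)
      (fun i j h => by have := Nat.eq_of_mul_eq_mul_right hkpos h; omega)
      (fun i j h => by
        rw [← hk, ← Nat.succ_mul] at h
        have := Nat.eq_of_mul_eq_mul_right hkpos h; omega) (M / 2) x
    set x₁ := run ((List.range (M / 2)).flatMap fun i => U l ((2 * i + 1) * k)) x with hx₁
    obtain ⟨b1, b2⟩ := ih (l + 1) (by rwa [show l + 1 + f = l + (f + 1) by ring]) x₁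
    set x₂ := run (ladder U n f (l + 1)) x₁ with hx₂
    obtain ⟨c1, c2⟩ := hU.run_flatMap (l := l) (s := fun i => 2 * i * k)
      (fun i j h => by have := Nat.eq_of_mul_eq_mul_right hkpos h; omega)
      (fun i j h => by
        rw [← hk, ← Nat.succ_mul] at h
        have := Nat.eq_of_mul_eq_mul_right hkpos h; omega) ((M + 1) / 2) x₂
    set y := run ((List.range ((M + 1) / 2)).flatMap fun i => U l (2 * i * k)) x₂ with hy
    have hrun : run (ladder U n (f + 1) l) x = y := by
      rw [ladder, run_append, run_append]
    rw [hrun]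
    simp only [← hk, ← Nat.succ_mul, Nat.succ_eq_add_one] at a1 a2 c1 c2
    rw [hM'] at b1 b2
    have hdouble : ∀ j : ℕ, j * 2 ^ (l + 1) = 2 * j * k := fun j => by rw [pow_succ]; ring
    simp only [hdouble] at b1 b2
    have o1 : ∀ i, x₁ (2 * i + 1) = x (2 * i + 1) := fun i => a1 _ fun j _ => hodd _ _
    have o2 : ∀ i, x₂ (2 * i + 1) = x (2 * i + 1) := fun i => by
      rw [b1 _ fun j _ => hodd _ _, o1]
    refine ⟨fun v hv => ?_, fun j hj => ?_⟩
    · rw [c1 v fun i hi => hv (2 * i) (by omega), b1 v fun i hi => ?_,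
        a1 v fun i hi => hv (2 * i + 1) (by omega)]
      have := hv (2 * i + 1) (by omega)
      rwa [show 2 * (i + 1) = 2 * i + 1 + 1 by ring]
    · rcases Nat.even_or_odd' j with ⟨i, rfl | rfl⟩
      · rw [c2 i (by omega), c1 _ fun m _ => hne _ _ (by omega),
          b1 _ fun m _ => hne _ _ (by omega), a1 _ fun m _ => hne _ _ (by omega),
          hU.congr l (2 * i * k) x₂ x o2]
      · have h2 := b2 i (by omega)
        rw [show 2 * (i + 1) = 2 * i + 1 + 1 by ring] at h2
        rw [c1 _ fun m _ => hne _ _ (by omega), h2, a2 i (by omega), c2 i (by omega),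
          b1 (2 * ((2 * i + 1) * k)) fun m _ => hne _ _ (by omega),
          a1 (2 * ((2 * i + 1) * k)) fun m _ => hne _ _ (by omega),
          hU.merge, hU.congr l _ x₁ x o1, hU.congr l _ x₁ x o1, hU.congr l (2 * i * k) x₂ x o2,
          ← hk, ← Nat.succ_mul]
        cases x (2 * ((2 * i + 1 + 1) * k)) <;> cases x (2 * ((2 * i + 1) * k)) <;>
          cases x₂ (2 * (2 * i * k)) <;> cases β l (2 * i * k) x <;>
          cases β l ((2 * i + 1) * k) x <;> rfl

theorem IsBlockFamily.actsOn_ladder (hU : IsBlockFamily U β) (n f l : ℕ) :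
    ActsOn (ladder U n f l) fun v => v ≤ 2 * n := by
  induction f generalizing l with
  | zero => exact actsOn_nil _
  | succ f ih =>
    have key : ∀ j < n / 2 ^ l, ActsOn (U l (j * 2 ^ l)) fun v => v ≤ 2 * n := by
      intro j hj
      refine (hU.actsOn l (j * 2 ^ l)).mono fun v hv => ?_
      have h1 : (j + 1) * 2 ^ l ≤ n :=
        (Nat.mul_le_mul_right _ hj).trans (Nat.div_mul_le_self n (2 ^ l))
      rw [Nat.succ_mul] at h1
      omega
    refine ((actsOn_flatMap fun i hi => ?_).append (ih (l + 1))).append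
      (actsOn_flatMap fun i hi => ?_)
    · rw [List.mem_range] at hi
      exact key _ (by omega)
    · rw [List.mem_range] at hi
      exact key _ (by omega)

theorem length_flatMap_range_le {g : ℕ → Circuit ℕ} {c : ℕ} (hg : ∀ i, (g i).length ≤ c) (N : ℕ) :
    ((List.range N).flatMap g).length ≤ N * c := by
  induction N with
  | zero => simp
  | succ N ih =>
    have := hg N
    simp only [List.range_succ, List.flatMap_append, List.length_append, List.flatMap_cons,
      List.flatMap_nil, List.append_nil, Nat.succ_mul]
    omega

theorem length_ladder_le {c : ℕ} (hc : ∀ l s, (U l s).length ≤ c * 2 ^ l) (n f l : ℕ) :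
    (ladder U n f l).length ≤ f * (c * n) := by
  induction f generalizing l with
  | zero => simp [ladder]
  | succ f ih =>
    have h1 := length_flatMap_range_le (fun i => hc l ((2 * i + 1) * 2 ^ l)) (n / 2 ^ l / 2)
    have h2 := length_flatMap_range_le (fun i => hc l (2 * i * 2 ^ l)) ((n / 2 ^ l + 1) / 2)
    have h3 := ih (l + 1)
    have h4 : n / 2 ^ l / 2 * (c * 2 ^ l) + (n / 2 ^ l + 1) / 2 * (c * 2 ^ l) ≤ c * n := by
      rw [← add_mul, show n / 2 ^ l / 2 + (n / 2 ^ l + 1) / 2 = n / 2 ^ l by omega,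
        mul_left_comm]
      exact Nat.mul_le_mul_left c (Nat.div_mul_le_self n (2 ^ l))
    have h5 : (f + 1) * (c * n) = f * (c * n) + c * n := Nat.succ_mul _ _
    simp only [ladder, List.length_append]
    omega

/-- Blocks of the same level whose places have the same parity can be carried out in parallel. -/
theorem IsBlockFamily.depthLE_flatMap (hU : IsBlockFamily U β) {l d : ℕ}
    (hd : ∀ s, DepthLE (U l s) d) {s : ℕ → ℕ} (hs : ∀ i j, i < j → s i + 2 ^ l < s j) (N : ℕ) :
    DepthLE ((List.range N).flatMap fun i => U l (s i)) d := by
  refine QuantumAdder.depthLE_flatMap (fun i _ => hd _) ?_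
  refine List.pairwise_lt_range.imp fun {i j} hij g hg g' hg' => ?_
  rw [Finset.disjoint_left]
  intro v hv hv'
  have h1 := hU.actsOn l (s i) g hg v hv
  have h2 := hU.actsOn l (s j) g' hg' v hv'
  have := hs i j hij
  omega

theorem IsBlockFamily.depthLE_ladder (hU : IsBlockFamily U β) {D : ℕ}
    (hD : ∀ l s, DepthLE (U l s) (D * (l + 1))) (n f l : ℕ) :
    DepthLE (ladder U n f l) (2 * f * (D * (l + f))) := by
  induction f generalizing l with
  | zero => exact (depthLE_length (Q := ℕ) []).mono (Nat.zero_le _)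
  | succ f ih =>
    have hs : ∀ p i j : ℕ, i < j → (2 * i + p) * 2 ^ l + 2 ^ l < (2 * j + p) * 2 ^ l := by
      intro p i j hij
      rw [← Nat.succ_mul]
      exact Nat.mul_lt_mul_of_pos_right (by omega) (by positivity)
    have h1 := hU.depthLE_flatMap (hD l) (hs 1) (n / 2 ^ l / 2)
    have h2 := hU.depthLE_flatMap (hD l) (hs 0) ((n / 2 ^ l + 1) / 2)
    refine ((h1.append (ih (l + 1))).append h2).mono ?_
    have h3 : D * (l + 1) ≤ D * (l + (f + 1)) := Nat.mul_le_mul_left D (by omega)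
    rw [show l + 1 + f = l + (f + 1) by ring]
    nlinarith

end Ladder

/-! ### The adder -/

/-- The state in which wire `2 * i` holds `f i` and wire `2 * i + 1` holds `g i`. -/
def interleave (f g : ℕ → Bool) : ℕ → Bool := fun v => if v % 2 = 0 then f (v / 2) else g (v / 2)

theorem interleave_even (f g : ℕ → Bool) (i : ℕ) : interleave f g (2 * i) = f i := by
  simp [interleave]

theorem interleave_odd (f g : ℕ → Bool) (i : ℕ) : interleave f g (2 * i + 1) = g i := by
  rw [interleave, if_neg (by omega), show (2 * i + 1) / 2 = i by omega]

theorem eq_interleave {x : ℕ → Bool} {f g : ℕ → Bool} (hf : ∀ i, x (2 * i) = f i)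
    (hg : ∀ i, x (2 * i + 1) = g i) : x = interleave f g := by
  ext v
  rcases Nat.even_or_odd' v with ⟨i, rfl | rfl⟩
  · rw [hf, interleave_even]
  · rw [hg, interleave_odd]

/-- The ladder on the first `n` bits, with enough recursion depth. -/
def fullLadder (U : ℕ → ℕ → Circuit ℕ) (n : ℕ) : Circuit ℕ := ladder U n (Nat.log 2 n + 1) 0

theorem IsBlockFamily.run_fullLadder {U : ℕ → ℕ → Circuit ℕ} {β : ℕ → ℕ → (ℕ → Bool) → Bool}
    (hU : IsBlockFamily U β) {n : ℕ} {f f' g : ℕ → Bool} (h0 : f' 0 = f 0)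
    (hs : ∀ j < n, f' (j + 1) = (f (j + 1) ^^ (f' j && β 0 j (interleave f g))))
    (hn : ∀ i, n < i → f' i = f i) :
    run (fullLadder U n) (interleave f g) = interleave f' g := by
  have hlog : n < 2 ^ (0 + (Nat.log 2 n + 1)) := by
    rw [Nat.zero_add]; exact Nat.lt_pow_succ_log_self one_lt_two n
  obtain ⟨h1, h2⟩ := hU.run_ladder n (Nat.log 2 n + 1) 0 hlog (interleave f g)
  simp only [pow_zero, Nat.div_one, mul_one] at h1 h2
  refine eq_interleave (fun i => ?_) fun i => ?_
  · induction i with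
    | zero =>
      rw [fullLadder, h1 _ fun j _ => by omega, interleave_even, h0]
    | succ i ih =>
      rcases Nat.lt_or_ge i n with hi | hi
      · rw [fullLadder] at ih ⊢
        rw [h2 i hi, ih, hs i hi, interleave_even]
      · rw [fullLadder, h1 _ fun j _ => by omega, interleave_even, hn _ (by omega)]
  · rw [fullLadder, h1 _ fun j _ => by omega, interleave_odd]

theorem run_fullLadder_cnot {n : ℕ} {f f' g : ℕ → Bool} (h0 : f' 0 = f 0)
    (hs : ∀ j < n, f' (j + 1) = (f (j + 1) ^^ f' j)) (hn : ∀ i, n < i → f' i = f i) :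
    run (fullLadder (fun l s => cnot (2 * s) (2 * (s + 2 ^ l))) n) (interleave f g) =
      interleave f' g :=
  isBlockFamily_cnot.run_fullLadder h0 (by simpa using hs) hn

theorem run_fullLadder_blockMCX {n : ℕ} {f f' g : ℕ → Bool} (h0 : f' 0 = f 0)
    (hs : ∀ j < n, f' (j + 1) = (f (j + 1) ^^ (f' j && g j))) (hn : ∀ i, n < i → f' i = f i) :
    run (fullLadder blockMCX n) (interleave f g) = interleave f' g := by
  refine isBlockFamily_blockMCX.run_fullLadder h0 (fun j hj => ?_) hn
  rw [hs j hj]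
  simp [allOnes, interleave_odd]

/-- The layer of `CNOT` gates that XORs the first register onto the second. -/
def xorLayer (n : ℕ) : Circuit ℕ := (List.range n).flatMap fun i => cnot (2 * i) (2 * i + 1)

/-- The layer of `X` gates that flips the second register. -/
def notLayer (n : ℕ) : Circuit ℕ := (List.range n).flatMap fun i => [.X (2 * i + 1)]

theorem run_xorLayer (n : ℕ) (f g : ℕ → Bool) :
    run (xorLayer n) (interleave f g) =
      interleave f fun i => if i < n then g i ^^ f i else g i := by
  unfold xorLayer
  induction n with
  | zero => simp
  | succ n ih =>
    simp only [List.range_succ, List.flatMap_append, run_append, ih, List.flatMap_cons,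
      List.flatMap_nil, List.append_nil]
    rw [run_cnot (by omega), interleave_even, interleave_odd]
    refine eq_interleave (fun i => ?_) fun i => ?_
    · rw [Function.update_of_ne (by omega), interleave_even]
    · by_cases h : i = n
      · subst h; simp
      · rw [Function.update_of_ne (by omega), interleave_odd]
        simp only [show i < n + 1 ↔ i < n by omega]

theorem run_notLayer (n : ℕ) (f g : ℕ → Bool) :
    run (notLayer n) (interleave f g) = interleave f fun i => if i < n then !g i else g i := by
  unfold notLayer
  induction n with
  | zero => simp
  | succ n ih =>
    simp only [List.range_succ, List.flatMap_append, run_append, ih, List.flatMap_cons,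
      List.flatMap_nil, List.append_nil, run_cons, run_nil, Gate.action]
    rw [interleave_odd]
    refine eq_interleave (fun i => ?_) fun i => ?_
    · rw [Function.update_of_ne (by omega), interleave_even]
    · by_cases h : i = n
      · subst h; simp
      · rw [Function.update_of_ne (by omega), interleave_odd]
        simp only [show i < n + 1 ↔ i < n by omega]

/-- The adder on the wires `0, …, 2 * n`: wire `2 * i` with `i < n` is bit `i` of the first register,
wire `2 * i + 1` is bit `i` of the second, and wire `2 * n` is the carry out. -/
def adder (n : ℕ) : Circuit ℕ :=
  xorLayer n ++ ((fullLadder (fun l s => cnot (2 * s) (2 * (s + 2 ^ l))) n).reverse ++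
    (fullLadder blockMCX n ++ (xorLayer n ++ (notLayer n ++
      ((fullLadder blockMCX (n - 1)).reverse ++ (notLayer n ++
        (fullLadder (fun l s => cnot (2 * s) (2 * (s + 2 ^ l))) (n - 1) ++ xorLayer n)))))))

/-- Here `c i` is the carry into place `i`. -/
theorem run_adder {n : ℕ} {f g c : ℕ → Bool} (h0 : c 0 = false)
    (hs : ∀ i < n, c (i + 1) = Bool.atLeastTwo (f i) (g i) (c i)) :
    run (adder n) (interleave f g) = interleave (fun i => if i = n then f i ^^ c i else f i)
      fun i => if i < n then f i ^^ (g i ^^ c i) else g i := by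
  have e2 : run (fullLadder (fun l s => cnot (2 * s) (2 * (s + 2 ^ l))) n).reverse
      (interleave f fun i => if i < n then g i ^^ f i else g i) =
      interleave (fun i => if 0 < i ∧ i ≤ n then f i ^^ f (i - 1) else f i)
        fun i => if i < n then g i ^^ f i else g i := by
    refine run_reverse_of_run_eq (run_fullLadder_cnot (by simp) (fun j hj => ?_) fun i hi => ?_)
    · rw [if_pos (by omega), Nat.add_sub_cancel]
      cases f (j + 1) <;> cases f j <;> rfl
    · rw [if_neg (by omega)]
  have e3 : run (fullLadder blockMCX n)
      (interleave (fun i => if 0 < i ∧ i ≤ n then f i ^^ f (i - 1) else f i)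
        fun i => if i < n then g i ^^ f i else g i) =
      interleave (fun i => if i ≤ n then f i ^^ c i else f i)
        fun i => if i < n then g i ^^ f i else g i := by
    refine run_fullLadder_blockMCX (by simp [h0]) (fun j hj => ?_) fun i hi => ?_
    · rw [if_pos (by omega), if_pos (by omega), if_pos (by omega), if_pos (by omega), hs j hj,
        Nat.add_sub_cancel]
      cases f (j + 1) <;> cases f j <;> cases g j <;> cases c j <;> rfl
    · rw [if_neg (by omega), if_neg (by omega)]
  -- the second register now holds the negation of `g i ^^ c i`
  have e5 : (fun i => if i < n then
        !(if i < n then (if i < n then g i ^^ f i else g i) ^^ (if i ≤ n then f i ^^ c i else f i)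
          else if i < n then g i ^^ f i else g i)
      else if i < n then (if i < n then g i ^^ f i else g i) ^^ (if i ≤ n then f i ^^ c i else f i)
          else if i < n then g i ^^ f i else g i) =
      fun i => if i < n then !(g i ^^ c i) else g i := by
    ext i
    by_cases h : i < n
    · simp only [h, h.le, if_true]
      cases f i <;> cases g i <;> cases c i <;> rfl
    · simp only [h, if_false]
  have e6 : run (fullLadder blockMCX (n - 1)).reverse
      (interleave (fun i => if i ≤ n then f i ^^ c i else f i)
        fun i => if i < n then !(g i ^^ c i) else g i) =
      interleave (fun i => if i = n then f i ^^ c i else if 0 < i ∧ i < n then f i ^^ f (i - 1)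
          else f i)
        fun i => if i < n then !(g i ^^ c i) else g i := by
    refine run_reverse_of_run_eq (run_fullLadder_blockMCX ?_ (fun j hj => ?_) fun i hi => ?_)
    · simp [h0]
    · rw [if_pos (by omega), if_neg (by omega), if_pos (by omega), if_pos (by omega),
        if_pos (by omega), hs j (by omega), Nat.add_sub_cancel]
      cases f (j + 1) <;> cases f j <;> cases g j <;> cases c j <;> rfl
    · rcases Nat.lt_trichotomy i n with h | h | h
      · omega
      · rw [if_pos (by omega), if_pos h]
      · rw [if_neg (by omega), if_neg (by omega), if_neg (by omega)]
  have e7 : (fun i => if i < n then !(if i < n then !(g i ^^ c i) else g i)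
      else if i < n then !(g i ^^ c i) else g i) = fun i => if i < n then g i ^^ c i else g i := by
    ext i
    by_cases h : i < n <;> simp [h]
  have e8 : run (fullLadder (fun l s => cnot (2 * s) (2 * (s + 2 ^ l))) (n - 1))
      (interleave (fun i => if i = n then f i ^^ c i else if 0 < i ∧ i < n then f i ^^ f (i - 1)
          else f i)
        fun i => if i < n then g i ^^ c i else g i) =
      interleave (fun i => if i = n then f i ^^ c i else f i)
        fun i => if i < n then g i ^^ c i else g i := by
    refine run_fullLadder_cnot (by simp) (fun j hj => ?_) fun i hi => ?_
    · rw [if_neg (by omega), if_neg (by omega), if_pos (by omega), if_neg (by omega),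
        Nat.add_sub_cancel]
      cases f (j + 1) <;> cases f j <;> rfl
    · by_cases h : i = n
      · rw [if_pos h, if_pos h]
      · rw [if_neg h, if_neg h, if_neg (by omega)]
  have e9 : (fun i => if i < n then (if i < n then g i ^^ c i else g i) ^^
        (if i = n then f i ^^ c i else f i) else if i < n then g i ^^ c i else g i) =
      fun i => if i < n then f i ^^ (g i ^^ c i) else g i := by
    ext i
    by_cases h : i < n
    · simp only [h, h.ne, if_true, if_false]
      rw [Bool.xor_comm]
    · simp only [h, if_false]
  simp only [adder, run_append, run_xorLayer, run_notLayer, e2, e3, e5, e6, e7, e8, e9]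

theorem actsOn_adder (n : ℕ) : ActsOn (adder n) fun v => v ≤ 2 * n := by
  have hx : ActsOn (xorLayer n) fun v => v ≤ 2 * n := actsOn_flatMap fun i hi => by
    rw [List.mem_range] at hi
    exact actsOn_cnot (by omega) (by omega)
  have hn : ActsOn (notLayer n) fun v => v ≤ 2 * n := actsOn_flatMap fun i hi => by
    rw [List.mem_range] at hi
    exact actsOn_X (by omega)
  have hc := fun m => isBlockFamily_cnot.actsOn_ladder m (Nat.log 2 m + 1) 0
  have hb := fun m => isBlockFamily_blockMCX.actsOn_ladder m (Nat.log 2 m + 1) 0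
  exact hx.append ((hc n).reverse.append ((hb n).append (hx.append (hn.append
    (((hb (n - 1)).mono fun v hv => by omega).reverse.append (hn.append
      (((hc (n - 1)).mono fun v hv => by omega).append hx)))))))

theorem length_adder_le (n : ℕ) : (adder n).length ≤ 8197 * (n * (Nat.log 2 n + 1)) := by
  have hx : (xorLayer n).length ≤ n :=
    (length_flatMap_range_le (fun i => length_cnot_le (2 * i) (2 * i + 1)) n).trans_eq (mul_one n)
  have hn : (notLayer n).length ≤ n :=
    (length_flatMap_range_le (g := fun i => [.X (2 * i + 1)]) (c := 1)
      (fun _ => le_rfl) n).trans_eq (mul_one n)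
  have hc : ∀ m ≤ n, (fullLadder (fun l s => cnot (2 * s) (2 * (s + 2 ^ l))) m).length ≤
      2048 * (n * (Nat.log 2 n + 1)) := fun m hm => by
    refine (length_ladder_le (c := 2048) (fun l s => (length_cnot_le _ _).trans ?_) _ _ _).trans ?_
    · have : 0 < 2 ^ l := by positivity
      omega
    · calc (Nat.log 2 m + 1) * (2048 * m) ≤ (Nat.log 2 n + 1) * (2048 * n) := by gcongr
        _ = _ := by ring
  have hb : ∀ m ≤ n, (fullLadder blockMCX m).length ≤ 2048 * (n * (Nat.log 2 n + 1)) :=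
    fun m hm => by
      refine (length_ladder_le (c := 2048) (fun l s => length_blockMCX_le l s) _ _ _).trans ?_
      calc (Nat.log 2 m + 1) * (2048 * m) ≤ (Nat.log 2 n + 1) * (2048 * n) := by gcongr
        _ = _ := by ring
  have h1 := hc n le_rfl
  have h2 := hc (n - 1) (by omega)
  have h3 := hb n le_rfl
  have h4 := hb (n - 1) (by omega)
  have h5 : n ≤ n * (Nat.log 2 n + 1) := Nat.le_mul_of_pos_right n (by omega)
  simp only [adder, List.length_append, List.length_reverse]
  omega

theorem depthLE_adder (n : ℕ) : DepthLE (adder n) (131077 * (Nat.log 2 n + 1) ^ 2) := by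
  have hx : DepthLE (xorLayer n) 1 := by
    refine depthLE_flatMap (fun i _ => (depthLE_length _).mono (length_cnot_le _ _)) ?_
    refine List.pairwise_lt_range.imp fun {i j} hij g hg g' hg' => Finset.disjoint_left.2 ?_
    intro v hv hv'
    have h1 := actsOn_cnot (p := fun v => v = 2 * i ∨ v = 2 * i + 1) (Or.inl rfl) (Or.inr rfl)
      g hg v hv
    have h2 := actsOn_cnot (p := fun v => v = 2 * j ∨ v = 2 * j + 1) (Or.inl rfl) (Or.inr rfl)
      g' hg' v hv'
    omega
  have hn : DepthLE (notLayer n) 1 := by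
    refine depthLE_flatMap (fun i _ => depthLE_length _) ?_
    refine List.pairwise_lt_range.imp fun {i j} hij g hg g' hg' => Finset.disjoint_left.2 ?_
    intro v hv hv'
    have h1 := actsOn_X (p := fun v => v = 2 * i + 1) rfl g hg v hv
    have h2 := actsOn_X (p := fun v => v = 2 * j + 1) rfl g' hg' v hv'
    omega
  have key : ∀ m ≤ n, 2 * (Nat.log 2 m + 1) * (16384 * (0 + (Nat.log 2 m + 1))) ≤
      32768 * (Nat.log 2 n + 1) ^ 2 := fun m hm => by
    calc _ = 32768 * (Nat.log 2 m + 1) ^ 2 := by ring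
      _ ≤ _ := by gcongr
  have hc : ∀ m ≤ n, DepthLE (fullLadder (fun l s => cnot (2 * s) (2 * (s + 2 ^ l))) m)
      (32768 * (Nat.log 2 n + 1) ^ 2) := fun m hm =>
    (isBlockFamily_cnot.depthLE_ladder (D := 16384) (fun l s => (depthLE_length _).mono
      ((length_cnot_le _ _).trans (by omega))) _ _ _).mono (key m hm)
  have hb : ∀ m ≤ n, DepthLE (fullLadder blockMCX m) (32768 * (Nat.log 2 n + 1) ^ 2) :=
    fun m hm => (isBlockFamily_blockMCX.depthLE_ladder depthLE_blockMCX _ _ _).mono (key m hm)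
  have hpos : 1 ≤ (Nat.log 2 n + 1) ^ 2 := Nat.one_le_pow _ _ (by omega)
  exact (hx.append ((hc n le_rfl).reverse.append ((hb n le_rfl).append (hx.append (hn.append
    ((hb (n - 1) (by omega)).reverse.append (hn.append
      ((hc (n - 1) (by omega)).append hx)))))))).mono (by omega)

/-! ### Relabelling the wires -/

section Relabel

variable {Q : Type} [DecidableEq Q]

/-- The gate with its qubits renamed by `e`. The gate `X` serves as a junk value in case two
qubits of the gate obtain the same name. -/
def Gate.relabel (e : ℕ → Q) : Gate ℕ → Gate Q
  | .X t => .X (e t)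
  | .CNOT c t _ => if h : e c ≠ e t then .CNOT (e c) (e t) h else .X (e t)
  | .Toffoli c₁ c₂ t _ _ _ =>
    if h : e c₁ ≠ e c₂ ∧ e c₁ ≠ e t ∧ e c₂ ≠ e t then
      .Toffoli (e c₁) (e c₂) (e t) h.1 h.2.1 h.2.2 else .X (e t)

variable {e : ℕ → Q} {p : ℕ → Prop}

theorem Gate.support_relabel (he : ∀ v w, p v → p w → e v = e w → v = w) {g : Gate ℕ}
    (hg : ∀ v ∈ g.support, p v) : (g.relabel e).support = g.support.image e := by
  have hne : ∀ v ∈ g.support, ∀ w ∈ g.support, v ≠ w → e v ≠ e w := fun v hv w hw hvw h =>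
    hvw (he v w (hg v hv) (hg w hw) h)
  cases g with
  | X t => simp [Gate.relabel, Gate.support]
  | CNOT c t h =>
    have := hne c (by simp [Gate.support]) t (by simp [Gate.support]) h
    simp [Gate.relabel, Gate.support, this, Finset.image_insert]
  | Toffoli c₁ c₂ t h h₁ h₂ =>
    have a := hne c₁ (by simp [Gate.support]) c₂ (by simp [Gate.support]) h
    have b := hne c₁ (by simp [Gate.support]) t (by simp [Gate.support]) h₁
    have c := hne c₂ (by simp [Gate.support]) t (by simp [Gate.support]) h₂
    simp [Gate.relabel, Gate.support, a, b, c, Finset.image_insert]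

theorem Gate.action_relabel (he : ∀ v w, p v → p w → e v = e w → v = w) {g : Gate ℕ}
    (hg : ∀ v ∈ g.support, p v) {x : Q → Bool} {y : ℕ → Bool} (hxy : ∀ v, p v → x (e v) = y v) :
    ∀ v, p v → (g.relabel e).action x (e v) = g.action y v := by
  have hne : ∀ v ∈ g.support, ∀ w ∈ g.support, v ≠ w → e v ≠ e w := fun v hv w hw hvw h =>
    hvw (he v w (hg v hv) (hg w hw) h)
  have hupd : ∀ t, p t → ∀ b v, p v →
      Function.update x (e t) b (e v) = Function.update y t b v := by
    intro t ht b v hv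
    by_cases h : v = t
    · subst h; simp
    · rw [Function.update_of_ne h, Function.update_of_ne fun h' => h (he v t hv ht h'), hxy v hv]
  intro v hv
  cases g with
  | X t =>
    have pt := hg t (by simp [Gate.support])
    simp only [Gate.relabel, Gate.action]
    rw [hupd t pt _ v hv, hxy t pt]
  | CNOT c t h =>
    have pc := hg c (by simp [Gate.support])
    have pt := hg t (by simp [Gate.support])
    have a := hne c (by simp [Gate.support]) t (by simp [Gate.support]) h
    simp only [Gate.relabel, a, ne_eq, not_false_eq_true, dite_true, Gate.action]
    rw [hupd t pt _ v hv, hxy t pt, hxy c pc]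
  | Toffoli c₁ c₂ t h h₁ h₂ =>
    have pc₁ := hg c₁ (by simp [Gate.support])
    have pc₂ := hg c₂ (by simp [Gate.support])
    have pt := hg t (by simp [Gate.support])
    have a := hne c₁ (by simp [Gate.support]) c₂ (by simp [Gate.support]) h
    have b := hne c₁ (by simp [Gate.support]) t (by simp [Gate.support]) h₁
    have c := hne c₂ (by simp [Gate.support]) t (by simp [Gate.support]) h₂
    simp only [Gate.relabel, a, b, c, ne_eq, not_false_eq_true, and_self, dite_true, Gate.action]
    rw [hupd t pt _ v hv, hxy t pt, hxy c₁ pc₁, hxy c₂ pc₂]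

theorem run_map_relabel (he : ∀ v w, p v → p w → e v = e w → v = w) {C : Circuit ℕ}
    (hC : ActsOn C p) {x : Q → Bool} {y : ℕ → Bool} (hxy : ∀ v, p v → x (e v) = y v) :
    ∀ v, p v → run (C.map (Gate.relabel e)) x (e v) = run C y v := by
  induction C generalizing x y with
  | nil => exact hxy
  | cons g C ih =>
    exact ih (fun g' hg' => hC g' (List.mem_cons_of_mem _ hg'))
      (g.action_relabel he (hC g List.mem_cons_self) hxy)

theorem DepthLE.map_relabel (he : ∀ v w, p v → p w → e v = e w → v = w) {C : Circuit ℕ}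
    (hC : ActsOn C p) {d : ℕ} (hd : DepthLE C d) : DepthLE (C.map (Gate.relabel e)) d := by
  intro l hl hc
  obtain ⟨l', hl', rfl⟩ := List.sublist_map_iff.1 hl
  rw [List.length_map]
  refine hd l' hl' ?_
  rw [List.isChain_map] at hc
  rw [List.isChain_iff_getElem] at hc ⊢
  intro i hi hdis
  have h1 := hC l'[i] (hl'.subset (List.getElem_mem _))
  have h2 := hC l'[i + 1] (hl'.subset (List.getElem_mem _))
  refine hc i hi ?_
  rw [Gate.support_relabel he h1, Gate.support_relabel he h2, Finset.disjoint_left]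
  intro q hq hq'
  obtain ⟨v, hv, rfl⟩ := Finset.mem_image.1 hq
  obtain ⟨w, hw, hvw⟩ := Finset.mem_image.1 hq'
  obtain rfl := he _ _ (h2 w hw) (h1 v hv) hvw
  exact Finset.disjoint_left.1 hdis hv hw

end Relabel

/-- The qubit of the adder that is represented by the wire `v ≤ 2 * n`. -/
def toQubit (n v : ℕ) : AdderQubit n :=
  if h : v / 2 < n then
    if v % 2 = 0 then .inl ⟨v / 2, h⟩ else .inr (.inl ⟨v / 2, h⟩)
  else .inr (.inr ())

theorem toQubit_even {n i : ℕ} (hi : i < n) : toQubit n (2 * i) = .inl ⟨i, hi⟩ := by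
  simp [toQubit, hi]

theorem toQubit_odd {n i : ℕ} (hi : i < n) : toQubit n (2 * i + 1) = .inr (.inl ⟨i, hi⟩) := by
  have h : (2 * i + 1) / 2 = i := by omega
  simp [toQubit, hi, h]

theorem toQubit_last (n : ℕ) : toQubit n (2 * n) = .inr (.inr ()) := by simp [toQubit]

theorem toQubit_injOn (n v w : ℕ) (hv : v ≤ 2 * n) (hw : w ≤ 2 * n)
    (h : toQubit n v = toQubit n w) : v = w := by
  unfold toQubit at h
  split_ifs at h <;> simp at h <;> omega

theorem implementsAddition_adder (n : ℕ) :
    ImplementsAddition n ((adder n).map (Gate.relabel (toQubit n))) := by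
  intro a b ha hb z
  rw [Circuit.operator_mulVec_ket]
  congr 1
  set f : ℕ → Bool := fun i => if i < n then a.testBit i else z with hf
  set g : ℕ → Bool := fun i => b.testBit i with hg
  set A := BitVec.ofNat (n + 1) a with hA
  set B := BitVec.ofNat (n + 1) b with hB
  set c : ℕ → Bool := fun i => BitVec.carry i A B false with hc
  have hAi : ∀ i ≤ n, A.getLsbD i = a.testBit i := fun i hi => by
    rw [hA, BitVec.getLsbD_ofNat]; simp; omega
  have hBi : ∀ i ≤ n, B.getLsbD i = b.testBit i := fun i hi => by
    rw [hB, BitVec.getLsbD_ofNat]; simp; omega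
  have hsum : ∀ i ≤ n, (a + b).testBit i = (a.testBit i ^^ (b.testBit i ^^ c i)) := by
    intro i hi
    have h1 := BitVec.getLsbD_add (i := i) (by omega : i < n + 1) A B
    rw [hAi i hi, hBi i hi] at h1
    rw [hc, ← h1, hA, hB, ← BitVec.ofNat_add, BitVec.getLsbD_ofNat]
    simp; omega
  have hrun := run_adder (n := n) (f := f) (g := g) (c := c) (by simp [hc]) (fun i hi => by
    simp only [hc, BitVec.carry_succ, hAi i hi.le, hBi i hi.le, hf, hg, if_pos hi])
  have hstart : ∀ v, v ≤ 2 * n → adderLabel n a b z (toQubit n v) = interleave f g v := by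
    intro v hv
    rcases Nat.even_or_odd' v with ⟨i, rfl | rfl⟩
    · rw [interleave_even]
      rcases Nat.lt_or_ge i n with hi | hi
      · simp [toQubit_even hi, adderLabel, hf, hi]
      · obtain rfl : i = n := by omega
        simp [toQubit_last, adderLabel, hf]
    · rw [interleave_odd, toQubit_odd (by omega)]
      rfl
  have hend := run_map_relabel (toQubit_injOn n) (actsOn_adder n) hstart
  rw [hrun] at hend
  ext q
  rcases q with i | i | u
  · have := hend (2 * i) (by omega)
    rw [toQubit_even i.2, interleave_even] at this
    rw [this]
    simp [adderLabel, hf, i.2.ne]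
  · have := hend (2 * i + 1) (by omega)
    rw [toQubit_odd i.2, interleave_odd] at this
    rw [this]
    simp only [adderLabel, hf, hg, i.2, if_true, Nat.testBit_mod_two_pow, decide_true,
      Bool.true_and, hsum i i.2.le]
  · have := hend (2 * n) le_rfl
    rw [toQubit_last, interleave_even] at this
    obtain rfl : u = () := rfl
    rw [this]
    simp only [adderLabel, hf, lt_irrefl, if_true, if_false, hsum n le_rfl,
      Nat.testBit_lt_two_pow ha, Nat.testBit_lt_two_pow hb, Bool.false_xor]

end QuantumAdder

theorem mainTheorem1 :
    ∃ C : (n : ℕ) → QuantumAdder.Circuit (QuantumAdder.AdderQubit n),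
      (∀ n : ℕ, QuantumAdder.ImplementsAddition n (C n)) ∧
      Asymptotics.IsBigO Filter.atTop
        (fun n : ℕ => (QuantumAdder.Circuit.depth (C n) : ℝ))
        (fun n : ℕ => (Real.logb 2 (n : ℝ)) ^ 2) ∧
      Asymptotics.IsBigO Filter.atTop
        (fun n : ℕ => (QuantumAdder.Circuit.gateCount (C n) : ℝ))
        (fun n : ℕ => (n : ℝ) * Real.logb 2 (n : ℝ)) := by
  have hlog : ∀ n : ℕ, 2 ≤ n → ((Nat.log 2 n + 1 : ℕ) : ℝ) ≤ 2 * Real.logb 2 n := by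
    intro n hn
    have h1 : ((Nat.log 2 n : ℕ) : ℝ) ≤ Real.logb 2 n := by
      exact_mod_cast Real.natLog_le_logb n 2
    have h2 : (1 : ℝ) ≤ Real.logb 2 n := by
      rw [Real.le_logb_iff_rpow_le one_lt_two (by positivity), Real.rpow_one]
      exact_mod_cast hn
    push_cast
    linarith
  refine ⟨fun n => (QuantumAdder.adder n).map (QuantumAdder.Gate.relabel (QuantumAdder.toQubit n)),
    QuantumAdder.implementsAddition_adder, ?_, ?_⟩
  · refine Asymptotics.IsBigO.of_bound (131077 * 4) ?_
    filter_upwards [Filter.eventually_ge_atTop 2] with n hn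
    rw [Real.norm_of_nonneg (by positivity), Real.norm_of_nonneg (by positivity)]
    have h := ((QuantumAdder.depthLE_adder n).map_relabel (QuantumAdder.toQubit_injOn n)
      (QuantumAdder.actsOn_adder n)).depth_le
    calc _ ≤ ((131077 * (Nat.log 2 n + 1) ^ 2 : ℕ) : ℝ) := by exact_mod_cast h
      _ = 131077 * ((Nat.log 2 n + 1 : ℕ) : ℝ) ^ 2 := by push_cast; ring
      _ ≤ 131077 * (2 * Real.logb 2 n) ^ 2 := by gcongr; exact hlog n hn
      _ = _ := by ring
  · refine Asymptotics.IsBigO.of_bound (8197 * 2) ?_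
    filter_upwards [Filter.eventually_ge_atTop 2] with n hn
    have hpos : 0 ≤ Real.logb 2 n := by
      have := hlog n hn
      have h0 : (0 : ℝ) ≤ ((Nat.log 2 n + 1 : ℕ) : ℝ) := by positivity
      linarith
    rw [Real.norm_of_nonneg (by positivity), Real.norm_of_nonneg (by positivity)]
    have h := QuantumAdder.length_adder_le n
    calc _ ≤ ((8197 * (n * (Nat.log 2 n + 1)) : ℕ) : ℝ) := by
          simp only [QuantumAdder.Circuit.gateCount, List.length_map]
          exact_mod_cast h
      _ = 8197 * (n * ((Nat.log 2 n + 1 : ℕ) : ℝ)) := by push_cast; ring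
      _ ≤ 8197 * (n * (2 * Real.logb 2 n)) := by gcongr; exact hlog n hn
      _ = _ := by ring
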